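/- Let $A\in\mathbb R^{n\times n}$, $B\in\mathbb R^{n\times m}$, $\epsilon>0$, $T>0$ and $x_0,x_f\in\mathbb R^n$. For $\sigma>0$ and $t\in[0,T]$ put $$m_t=e^{-At}x_f,\qquad Q_t=\epsilon^2\int_0^t e^{-A(t-s)}BB^\top e^{-A^\top(t-s)}\,\mathrm ds+\sigma^2e^{-At}e^{-A^\top t},$$ $$\hat k_\sigma(t,x)=-\epsilon^2B^\top Q_{T-t}^{-1}(x-m_{T-t}),\qquad M=\sigma^2I+\epsilon^2\int_0^Te^{As}BB^\top e^{A^\top s}\,\mathrm ds .$$ (Here $\mathcal N(m_t,Q_t)$ is the law of $Z_t$ when $\mathrm dZ_t=-AZ_t\,\mathrm dt+\epsilon B\,\mathrm dW_t$, $Z_0\sim\mathcal N(x_f,\sigma^2I)$.) Let $W$ be a standard $m$-dimensional Wiener process. Then: (1) For every $\sigma>0$ the closed-loop equation $$\mathrm dX_t=AX_t\,\mathrm dt+B\big(\hat k_\sigma(t,X_t)\,\mathrm dt+\epsilon\,\mathrm dW_t\big),\qquad X_0=x_0,$$ has a continuous solution on $[0,T]$, and every such solution satisfies $$\mathbb E\big[\|X_T-x_f\|^2\big]=\sigma^4\,\|e^{TA}x_0-x_f\|^2_{M^{-2}}+\sigma^2\big(n-\sigma^2\operatorname{Tr}(M^{-1})\big),$$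 where $\|x\|_P:=\sqrt{x^\top Px}$. (2) If $(A,B)$ is controllable, i.e. any state of $\dot x=Ax+Bu$ can be steered to any other state in finite time by a continuous input, then for every $\delta>0$ there is $\sigma_0>0$ such that for every $\sigma\in(0,\sigma_0]$ the feedback law $U_t=\hat k_\sigma(t,X_t)$ solves the approximate steering problem with tolerance $\delta$: the closed-loop equation has a solution and, for every solution, $U_t$ is adapted to the completed filtration generated by $W$ and $\mathbb E[\|X_T-x_f\|^2]\le\delta$. -/

import Mathlib

open MeasureTheory ProbabilityTheory Set
open scoped Matrix NNReal

universe u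

noncomputable section

namespace TerminalError

/-- A standard `m`-dimensional Wiener process: its coordinates are independent standard real
Brownian motions. -/
structure IsWiener {m : ℕ} {Ω : Type*} {mΩ : MeasurableSpace Ω}
    (W : ℝ≥0 → Ω → EuclideanSpace ℝ (Fin m)) (P : Measure Ω) : Prop where
  measurable : ∀ t, Measurable (W t)
  brownian : ∀ i, IsBrownianReal (fun t ω => W t ω i) P
  indep : iIndepFun (fun i ω => fun t : ℝ≥0 => W t ω i) P

/-- The σ-algebra `σ(W_s; 0 ≤ s ≤ t)`. -/
abbrev pastSigma {m : ℕ} {Ω : Type*} (W : ℝ≥0 → Ω → EuclideanSpace ℝ (Fin m)) (t : ℝ≥0) :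
    MeasurableSpace Ω :=
  ⨆ s : Iic t, MeasurableSpace.comap (W s) inferInstance

/-- `X` is, on `[0, T]`, a continuous solution of
`dX = A X dt + B (k(t, X) dt + ε dW)`, `X₀ = x₀`. As the diffusion matrix `ε B` is constant, the
stochastic integral of `ε B` against `W` over `[0, t]` is `ε B W_t`. -/
def IsClosedLoop {n m : ℕ} (A : Matrix (Fin n) (Fin n) ℝ) (B : Matrix (Fin n) (Fin m) ℝ)
    (ε T : ℝ) (x₀ : EuclideanSpace ℝ (Fin n))
    (k : ℝ → EuclideanSpace ℝ (Fin n) → EuclideanSpace ℝ (Fin m))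
    {Ω : Type*} {mΩ : MeasurableSpace Ω} (P : Measure Ω)
    (W : ℝ≥0 → Ω → EuclideanSpace ℝ (Fin m)) (X : ℝ → Ω → EuclideanSpace ℝ (Fin n)) : Prop :=
  ∀ᵐ ω ∂P,
    ContinuousOn (fun t => X t ω) (Icc 0 T) ∧
    IntervalIntegrable
      (fun s => A.toEuclideanLin (X s ω) + B.toEuclideanLin (k s (X s ω))) volume 0 T ∧
    ∀ t ∈ Icc 0 T,
      X t ω = x₀
        + (∫ s in (0 : ℝ)..t, (A.toEuclideanLin (X s ω) + B.toEuclideanLin (k s (X s ω))))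
        + ε • B.toEuclideanLin (W t.toNNReal ω)

/-- The feedback law `U_t = k(t, X_t)` solves the approximate steering problem with tolerance `δ`:
for every driving Wiener process, the closed-loop equation has a solution, and along every solution
the control is adapted to the (completed) filtration of the Wiener process and
`𝔼 ‖X_T - x_f‖² ≤ δ`. -/
def SolvesApproxSteering {n m : ℕ} (A : Matrix (Fin n) (Fin n) ℝ)
    (B : Matrix (Fin n) (Fin m) ℝ) (ε T : ℝ) (x₀ x_f : EuclideanSpace ℝ (Fin n)) (δ : ℝ)
    (k : ℝ → EuclideanSpace ℝ (Fin n) → EuclideanSpace ℝ (Fin m)) : Prop :=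
  ∀ (Ω : Type u) (_ : MeasurableSpace Ω) (P : Measure Ω) (_ : IsProbabilityMeasure P)
    (W : ℝ≥0 → Ω → EuclideanSpace ℝ (Fin m)), IsWiener W P →
    (∃ X, IsClosedLoop A B ε T x₀ k P W X) ∧
    ∀ X, IsClosedLoop A B ε T x₀ k P W X →
      (∀ t ∈ Icc 0 T, AEStronglyMeasurable[pastSigma W t.toNNReal] (fun ω => k t (X t ω)) P) ∧
      Integrable (fun ω => ‖X T ω - x_f‖ ^ 2) P ∧
      ∫ ω, ‖X T ω - x_f‖ ^ 2 ∂P ≤ δ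

/-- Entrywise integral of a matrix-valued function over `[0, t]`. -/
def matrixIntegral {n : ℕ} (t : ℝ) (F : ℝ → Matrix (Fin n) (Fin n) ℝ) :
    Matrix (Fin n) (Fin n) ℝ :=
  Matrix.of fun i j => ∫ s in (0 : ℝ)..t, F s i j

/-- `m_t = e^{-At} x_f`. -/
def meanZ {n : ℕ} (A : Matrix (Fin n) (Fin n) ℝ) (x_f : EuclideanSpace ℝ (Fin n)) (t : ℝ) :
    EuclideanSpace ℝ (Fin n) :=
  (NormedSpace.exp (-(t • A))).toEuclideanLin x_f

/-- `Σ_t = ε² ∫₀ᵗ e^{-A(t-s)} B Bᵀ e^{-Aᵀ(t-s)} ds`. -/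
def covSigma {n m : ℕ} (A : Matrix (Fin n) (Fin n) ℝ) (B : Matrix (Fin n) (Fin m) ℝ) (ε t : ℝ) :
    Matrix (Fin n) (Fin n) ℝ :=
  ε ^ 2 • matrixIntegral t fun s =>
    NormedSpace.exp (-((t - s) • A)) * B * Bᵀ * NormedSpace.exp (-((t - s) • Aᵀ))

/-- `Q_t = Σ_t + σ² e^{-At} e^{-Aᵀt}`. -/
def covQ {n m : ℕ} (A : Matrix (Fin n) (Fin n) ℝ) (B : Matrix (Fin n) (Fin m) ℝ) (ε σ t : ℝ) :
    Matrix (Fin n) (Fin n) ℝ :=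
  covSigma A B ε t + σ ^ 2 • (NormedSpace.exp (-(t • A)) * NormedSpace.exp (-(t • Aᵀ)))

/-- The regularized feedback law `k̂(t, x) = -ε² Bᵀ Q_{T-t}⁻¹ (x - m_{T-t})`. -/
def feedback {n m : ℕ} (A : Matrix (Fin n) (Fin n) ℝ) (B : Matrix (Fin n) (Fin m) ℝ)
    (ε T : ℝ) (x_f : EuclideanSpace ℝ (Fin n)) (σ t : ℝ) (x : EuclideanSpace ℝ (Fin n)) :
    EuclideanSpace ℝ (Fin m) :=
  -(ε ^ 2 • (Bᵀ * (covQ A B ε σ (T - t))⁻¹).toEuclideanLin (x - meanZ A x_f (T - t)))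

/-- `M = σ² I + ε² ∫₀ᵀ e^{As} B Bᵀ e^{Aᵀs} ds`. -/
def matM {n m : ℕ} (A : Matrix (Fin n) (Fin n) ℝ) (B : Matrix (Fin n) (Fin m) ℝ) (ε T σ : ℝ) :
    Matrix (Fin n) (Fin n) ℝ :=
  σ ^ 2 • (1 : Matrix (Fin n) (Fin n) ℝ) + ε ^ 2 • matrixIntegral T fun s =>
    NormedSpace.exp (s • A) * B * Bᵀ * NormedSpace.exp (s • Aᵀ)

/-- The weighted norm `‖x‖_P = √(xᵀ P x)`. -/
def weightedNorm {n : ℕ} (P : Matrix (Fin n) (Fin n) ℝ) (x : EuclideanSpace ℝ (Fin n)) : ℝ :=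
  √(x.ofLp ⬝ᵥ (P *ᵥ x.ofLp))

/-- Controllability of `ẋ = A x + B u`: any state can be steered to any other state in finite time
by a continuous input. -/
def Controllable {n m : ℕ} (A : Matrix (Fin n) (Fin n) ℝ) (B : Matrix (Fin n) (Fin m) ℝ) : Prop :=
  ∀ a b : EuclideanSpace ℝ (Fin n), ∃ τ : ℝ, 0 < τ ∧
    ∃ (u : ℝ → EuclideanSpace ℝ (Fin m)) (x : ℝ → EuclideanSpace ℝ (Fin n)),
      ContinuousOn u (Icc 0 τ) ∧ x 0 = a ∧ x τ = b ∧
      ∀ t ∈ Icc 0 τ,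
        HasDerivWithinAt x (A.toEuclideanLin (x t) + B.toEuclideanLin (u t)) (Icc 0 τ) t

end TerminalError

end

/-!
The closed loop is a linear equation with an explicit fundamental matrix. Write `τ = T - t` and
`M_τ = σ² I + ε² ∫₀^τ e^{As} B Bᵀ e^{Aᵀs} ds`, so that `M = M_T`. Pulling the exponentials through
the integral gives `Q_τ = e^{-Aτ} M_τ e^{-Aᵀτ}` (`covQ_eq`), and `Φ_t = e^{-Aτ} M_τ` satisfies
`Φ' = (A - ε² B Bᵀ Q_τ⁻¹) Φ` (`hasDerivAt_flow`, `drift_eq`). Variation of constants around the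
centre `m_τ` then gives `X_t = m_τ + Φ_t Z_t` with
`Z_t = Φ_0⁻¹ (x₀ - m_T) + ε ∫₀ᵗ Φ_s⁻¹ B dW_s`.

The integrand is deterministic and continuously differentiable, so the stochastic integral is
defined path by path through integration by parts. Existence is then a computation on each
continuous path (`pathSolution_spec`) and uniqueness is Gronwall's inequality (`path_unique`); every
solution is therefore almost surely the explicit one, and questions about all solutions become
questions about Wiener integrals. At the terminal time `X_T - x_f = σ² Z_T`, because `m_0 = x_f` and
`Φ_T = σ² I`.

The second moment of `Z_T` follows from the Itô isometry
(`integral_wienerIntegral_mul_wienerIntegral`), which needs only the covariance of Brownian motion,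
Fubini's theorem and integration by parts. The initial term `Φ_0⁻¹ (x₀ - m_T)` equals
`M⁻¹ (e^{AT} x₀ - x_f)`, and the variance is `∫₀ᵀ tr (F Fᵀ) dt` with `F = ε Φ⁻¹ B`, whose integrand
is the derivative of `tr (M_{T-t}⁻¹)`; hence it equals `n / σ² - tr (M⁻¹)`
(`integral_sum_noiseKernel_sq`).

Both Fubini's theorem and the adaptedness of the control require a version of `W` that is jointly
measurable with respect to the past up to the current time; an upper limit of left-point
approximations provides it (`exists_measurable_uncurry_of_continuous`).

If `(A, B)` is controllable, the Gramian over `[0, T]` is invertible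
(`Controllable.det_gramian_ne_zero`). Then `M⁻¹` stays bounded as `σ → 0`, and the formula for the
error tends to `0` (`Controllable.tendsto_terminalError`).
-/

noncomputable section

namespace TerminalError

/-! ### Calculus of matrix-valued functions -/

section MatrixCalculus

variable {l m n : ℕ}

/-- Differentiability of a matrix-valued function is entrywise. Only the product topology on
matrices is involved, so no matrix norm has to be chosen. -/
theorem hasDerivAt_matrix_iff {F : ℝ → Matrix (Fin m) (Fin n) ℝ} {F' : Matrix (Fin m) (Fin n) ℝ}
    {t : ℝ} : HasDerivAt F F' t ↔ ∀ i j, HasDerivAt (fun s => F s i j) (F' i j) t :=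
  Iff.trans (hasDerivAt_pi (φ := F) (φ' := F')) (forall_congr' fun _ => hasDerivAt_pi)

theorem hasDerivAt_matrix_mul {F : ℝ → Matrix (Fin l) (Fin m) ℝ} {G : ℝ → Matrix (Fin m) (Fin n) ℝ}
    {F' : Matrix (Fin l) (Fin m) ℝ} {G' : Matrix (Fin m) (Fin n) ℝ} {t : ℝ}
    (hF : HasDerivAt F F' t) (hG : HasDerivAt G G' t) :
    HasDerivAt (fun s => F s * G s) (F' * G t + F t * G') t := by
  rw [hasDerivAt_matrix_iff] at *
  intro i j
  simp only [Matrix.mul_apply, Matrix.add_apply, ← Finset.sum_add_distrib]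
  exact HasDerivAt.fun_sum fun k _ => (hF i k).mul (hG k j)

theorem continuousAt_of_hasDerivAt_matrix {F : ℝ → Matrix (Fin m) (Fin n) ℝ}
    {F' : Matrix (Fin m) (Fin n) ℝ} {t : ℝ} (h : HasDerivAt F F' t) : ContinuousAt F t :=
  continuousAt_pi.2 fun i => continuousAt_pi.2 fun j =>
    (hasDerivAt_matrix_iff.1 h i j).continuousAt

theorem hasDerivAt_of_euclidean {v : ℝ → EuclideanSpace ℝ (Fin n)}
    {v' : EuclideanSpace ℝ (Fin n)} {t : ℝ} (h : ∀ i, HasDerivAt (fun s => v s i) (v' i) t) :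
    HasDerivAt v v' t := by
  have h1 : HasDerivAt (fun s => (v s).ofLp) v'.ofLp t := hasDerivAt_pi.2 h
  exact ((EuclideanSpace.equiv (Fin n) ℝ).symm.toContinuousLinearMap.hasFDerivAt.comp_hasDerivAt
    t h1)

theorem hasDerivAt_toEuclideanLin {F : ℝ → Matrix (Fin m) (Fin n) ℝ} {F' : Matrix (Fin m) (Fin n) ℝ}
    {v : ℝ → EuclideanSpace ℝ (Fin n)} {v' : EuclideanSpace ℝ (Fin n)} {t : ℝ}
    (hF : HasDerivAt F F' t) (hv : HasDerivAt v v' t) :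
    HasDerivAt (fun s => (F s).toEuclideanLin (v s))
      (F'.toEuclideanLin (v t) + (F t).toEuclideanLin v') t := by
  rw [hasDerivAt_matrix_iff] at hF
  have hv' (k) : HasDerivAt (fun s => v s k) (v' k) t :=
    (EuclideanSpace.proj (𝕜 := ℝ) k).hasFDerivAt.comp_hasDerivAt t hv
  refine hasDerivAt_of_euclidean fun i => ?_
  simp only [Matrix.toLpLin_apply, Matrix.mulVec, dotProduct, PiLp.add_apply,
    ← Finset.sum_add_distrib]
  exact HasDerivAt.fun_sum fun k _ => (hF i k).mul (hv' k)

theorem continuousOn_toEuclideanLin {X : Type*} [TopologicalSpace X] {s : Set X}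
    {F : X → Matrix (Fin m) (Fin n) ℝ} {v : X → EuclideanSpace ℝ (Fin n)}
    (hF : ContinuousOn F s) (hv : ContinuousOn v s) :
    ContinuousOn (fun x => (F x).toEuclideanLin (v x)) s := by
  simp only [Matrix.toLpLin_apply]
  fun_prop

theorem hasDerivAt_exp_smul (A : Matrix (Fin n) (Fin n) ℝ) (t : ℝ) :
    HasDerivAt (fun s : ℝ => NormedSpace.exp (s • A)) (A * NormedSpace.exp (t • A)) t := by
  let _ : NormedRing (Matrix (Fin n) (Fin n) ℝ) := Matrix.linftyOpNormedRing
  let _ : NormedAlgebra ℝ (Matrix (Fin n) (Fin n) ℝ) := Matrix.linftyOpNormedAlgebra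
  exact hasDerivAt_exp_smul_const' A t

@[fun_prop]
theorem continuous_exp_smul (A : Matrix (Fin n) (Fin n) ℝ) :
    Continuous fun s : ℝ => NormedSpace.exp (s • A) :=
  continuous_iff_continuousAt.2 fun t => continuousAt_of_hasDerivAt_matrix (hasDerivAt_exp_smul A t)

theorem exp_smul_mul_exp_smul (A : Matrix (Fin n) (Fin n) ℝ) (s t : ℝ) :
    NormedSpace.exp (s • A) * NormedSpace.exp (t • A) = NormedSpace.exp ((s + t) • A) := by
  rw [add_smul, Matrix.exp_add_of_commute]
  exact ((Commute.refl A).smul_left s).smul_right t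

theorem hasDerivAt_matrix_inv {F : ℝ → Matrix (Fin n) (Fin n) ℝ} {F' : Matrix (Fin n) (Fin n) ℝ}
    {t : ℝ} (hF : HasDerivAt F F' t) (h : IsUnit (F t).det) :
    HasDerivAt (fun s => (F s)⁻¹) (-((F t)⁻¹ * F' * (F t)⁻¹)) t := by
  let _ : NormedRing (Matrix (Fin n) (Fin n) ℝ) := Matrix.linftyOpNormedRing
  let _ : NormedAlgebra ℝ (Matrix (Fin n) (Fin n) ℝ) := Matrix.linftyOpNormedAlgebra
  have hu : IsUnit (F t) := (Matrix.isUnit_iff_isUnit_det _).2 h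
  obtain ⟨u, hu⟩ := hu
  have h1 := hasFDerivAt_ringInverse (𝕜 := ℝ) u
  rw [hu] at h1
  have h2 := h1.comp_hasDerivAt t hF
  simp only [Matrix.nonsing_inv_eq_ringInverse, ← hu, Ring.inverse_unit]
  exact h2

theorem matrixIntegral_apply (t : ℝ) (F : ℝ → Matrix (Fin n) (Fin n) ℝ) (i j : Fin n) :
    matrixIntegral t F i j = ∫ s in (0 : ℝ)..t, F s i j := rfl

theorem hasDerivAt_matrixIntegral {F : ℝ → Matrix (Fin n) (Fin n) ℝ} (hF : Continuous F) (t : ℝ) :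
    HasDerivAt (fun s => matrixIntegral s F) (F t) t := by
  rw [hasDerivAt_matrix_iff]
  intro i j
  have h : Continuous fun s => F s i j := by fun_prop
  exact (h.integral_hasStrictDerivAt 0 t).hasDerivAt

theorem matrixIntegral_zero (F : ℝ → Matrix (Fin n) (Fin n) ℝ) : matrixIntegral 0 F = 0 := by
  ext i j
  simp [matrixIntegral_apply]

theorem mul_matrixIntegral_mul {F : ℝ → Matrix (Fin n) (Fin n) ℝ} (hF : Continuous F) (t : ℝ)
    (P Q : Matrix (Fin n) (Fin n) ℝ) :
    P * matrixIntegral t F * Q = matrixIntegral t fun s => P * F s * Q := by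
  have h (i j) : IntervalIntegrable (fun s => F s i j) volume 0 t :=
    Continuous.intervalIntegrable (by fun_prop) _ _
  ext i j
  simp only [matrixIntegral_apply, Matrix.mul_apply]
  rw [intervalIntegral.integral_finsetSum]
  · refine Finset.sum_congr rfl fun k _ => ?_
    rw [intervalIntegral.integral_mul_const, intervalIntegral.integral_finsetSum]
    · simp_rw [intervalIntegral.integral_const_mul]
    · exact fun l _ => (h l k).const_mul _
  · intro k _
    exact Continuous.intervalIntegrable (by fun_prop) _ _

theorem transpose_matrixIntegral (t : ℝ) (F : ℝ → Matrix (Fin n) (Fin n) ℝ) :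
    (matrixIntegral t F)ᵀ = matrixIntegral t fun s => (F s)ᵀ := rfl

theorem dotProduct_matrixIntegral_mulVec {F : ℝ → Matrix (Fin n) (Fin n) ℝ} (hF : Continuous F)
    (t : ℝ) (x y : Fin n → ℝ) :
    x ⬝ᵥ (matrixIntegral t F *ᵥ y) = ∫ s in (0 : ℝ)..t, x ⬝ᵥ (F s *ᵥ y) := by
  have h (i j) : IntervalIntegrable (fun s => F s i j) volume 0 t :=
    Continuous.intervalIntegrable (by fun_prop) _ _
  simp only [dotProduct, Matrix.mulVec, matrixIntegral_apply]
  rw [intervalIntegral.integral_finsetSum]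
  · refine Finset.sum_congr rfl fun k _ => ?_
    rw [intervalIntegral.integral_const_mul, intervalIntegral.integral_finsetSum]
    · simp_rw [intervalIntegral.integral_mul_const]
    · exact fun l _ => (h k l).mul_const _
  · intro k _
    exact Continuous.intervalIntegrable (by fun_prop) _ _

theorem toEuclideanLin_mul_apply (P : Matrix (Fin l) (Fin m) ℝ) (Q : Matrix (Fin m) (Fin n) ℝ)
    (x : EuclideanSpace ℝ (Fin n)) :
    (P * Q).toEuclideanLin x = P.toEuclideanLin (Q.toEuclideanLin x) := by
  simp

theorem toEuclideanLin_one_apply (x : EuclideanSpace ℝ (Fin n)) :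
    (1 : Matrix (Fin n) (Fin n) ℝ).toEuclideanLin x = x := by
  simp

end MatrixCalculus

/-! ### The fundamental matrix of the closed loop -/

section ClosedLoopFlow

variable {n m : ℕ} (A : Matrix (Fin n) (Fin n) ℝ) (B : Matrix (Fin n) (Fin m) ℝ) (ε T σ : ℝ)

/-- The controllability Gramian `∫₀ᵗ e^{As} B Bᵀ e^{Aᵀs} ds`. -/
def gramian (t : ℝ) : Matrix (Fin n) (Fin n) ℝ :=
  matrixIntegral t fun s => NormedSpace.exp (s • A) * B * Bᵀ * NormedSpace.exp (s • Aᵀ)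

/-- The matrix `Φ_t = e^{-A(T-t)} M_{T-t}`, where `M_τ = σ² I + ε² ∫₀^τ e^{As} B Bᵀ e^{Aᵀs} ds`. It
is a fundamental matrix of the noiseless closed loop: `Φ' = (A - ε² B Bᵀ Q_{T-t}⁻¹) Φ`. It is not
normalised to be the identity at time `0`; instead `Φ_T = σ² I`. -/
def flow (t : ℝ) : Matrix (Fin n) (Fin n) ℝ :=
  NormedSpace.exp (-((T - t) • A)) * matM A B ε (T - t) σ

/-- The derivative of `flow`, written without `Q_{T-t}⁻¹` so that it is visibly continuous on all
of `ℝ`, also past the horizon `T`, where `Q_{T-t}` may be singular. -/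
def flowDeriv (t : ℝ) : Matrix (Fin n) (Fin n) ℝ :=
  A * flow A B ε T σ t - ε ^ 2 • (B * Bᵀ * NormedSpace.exp ((T - t) • Aᵀ))

theorem matM_eq (t : ℝ) : matM A B ε t σ = σ ^ 2 • 1 + ε ^ 2 • gramian A B t := rfl

theorem exp_smul_transpose (t : ℝ) :
    NormedSpace.exp (t • Aᵀ) = (NormedSpace.exp (t • A))ᵀ := by
  rw [← Matrix.transpose_smul, Matrix.exp_transpose]

theorem exp_neg_smul_mul_exp_smul (t : ℝ) :
    NormedSpace.exp (-(t • A)) * NormedSpace.exp (t • A) = 1 := by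
  rw [← neg_smul, exp_smul_mul_exp_smul]; simp

theorem exp_smul_mul_exp_neg_smul (t : ℝ) :
    NormedSpace.exp (t • A) * NormedSpace.exp (-(t • A)) = 1 := by
  rw [← neg_smul, exp_smul_mul_exp_smul]; simp

theorem isUnit_det_exp_neg_smul (t : ℝ) : IsUnit (NormedSpace.exp (-(t • A))).det :=
  Matrix.isUnit_det_of_left_inverse (exp_smul_mul_exp_neg_smul A t)

theorem hasDerivAt_gramian (t : ℝ) : HasDerivAt (gramian A B)
    (NormedSpace.exp (t • A) * B * Bᵀ * NormedSpace.exp (t • Aᵀ)) t :=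
  hasDerivAt_matrixIntegral (by fun_prop) t

theorem gramian_transpose (t : ℝ) : (gramian A B t)ᵀ = gramian A B t := by
  rw [gramian, transpose_matrixIntegral]
  simp only [exp_smul_transpose, Matrix.transpose_mul, Matrix.transpose_transpose, Matrix.mul_assoc]

theorem matM_transpose (t : ℝ) : (matM A B ε t σ)ᵀ = matM A B ε t σ := by
  simp [matM_eq, gramian_transpose]

theorem dotProduct_gramian_mulVec (t : ℝ) (x : Fin n → ℝ) :
    x ⬝ᵥ (gramian A B t *ᵥ x) = ∫ s in (0 : ℝ)..t,
      ((NormedSpace.exp (s • A) * B)ᵀ *ᵥ x) ⬝ᵥ ((NormedSpace.exp (s • A) * B)ᵀ *ᵥ x) := by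
  rw [gramian, dotProduct_matrixIntegral_mulVec (by fun_prop)]
  congr with s
  rw [exp_smul_transpose, Matrix.mul_assoc _ Bᵀ, ← Matrix.transpose_mul, ← Matrix.mulVec_mulVec,
    Matrix.dotProduct_mulVec, Matrix.mulVec_transpose]

theorem dotProduct_gramian_mulVec_nonneg {t : ℝ} (ht : 0 ≤ t) (x : Fin n → ℝ) :
    0 ≤ x ⬝ᵥ (gramian A B t *ᵥ x) := by
  rw [dotProduct_gramian_mulVec]
  refine intervalIntegral.integral_nonneg ht fun s _ => ?_
  exact Finset.sum_nonneg fun i _ => mul_self_nonneg _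

variable {σ} in
theorem isUnit_det_matM (hσ : σ ≠ 0) {t : ℝ} (ht : 0 ≤ t) : IsUnit (matM A B ε t σ).det := by
  rw [isUnit_iff_ne_zero]
  intro h
  obtain ⟨x, hx, h0⟩ := Matrix.exists_mulVec_eq_zero_iff.2 h
  have h1 : x ⬝ᵥ (matM A B ε t σ *ᵥ x) = 0 := by rw [h0, dotProduct_zero]
  rw [matM_eq, Matrix.add_mulVec, Matrix.smul_mulVec, Matrix.smul_mulVec, Matrix.one_mulVec,
    dotProduct_add, dotProduct_smul, dotProduct_smul, smul_eq_mul, smul_eq_mul] at h1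
  have h2 := mul_nonneg (sq_nonneg ε) (dotProduct_gramian_mulVec_nonneg A B ht x)
  have h3 : 0 < x ⬝ᵥ x := by
    refine lt_of_le_of_ne (Finset.sum_nonneg fun i _ => mul_self_nonneg _) fun h => hx ?_
    exact dotProduct_self_eq_zero.1 h.symm
  have h4 : 0 < σ ^ 2 := by positivity
  nlinarith [mul_pos h4 h3]

theorem hasDerivAt_matM_sub (t : ℝ) : HasDerivAt (fun s => matM A B ε (T - s) σ)
    (-(ε ^ 2 • (NormedSpace.exp ((T - t) • A) * B * Bᵀ * NormedSpace.exp ((T - t) • Aᵀ)))) t := by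
  have h := hasDerivAt_gramian A B (T - t)
  rw [hasDerivAt_matrix_iff] at *
  intro i j
  have h1 := (((h i j).comp_const_sub T t).const_mul (ε ^ 2)).const_add
    ((σ ^ 2 • (1 : Matrix (Fin n) (Fin n) ℝ)) i j)
  refine h1.congr_deriv ?_
  simp

theorem hasDerivAt_exp_neg_sub (t : ℝ) :
    HasDerivAt (fun s => NormedSpace.exp (-((T - s) • A)))
      (A * NormedSpace.exp (-((T - t) • A))) t := by
  have h := hasDerivAt_exp_smul A (t - T)
  rw [hasDerivAt_matrix_iff] at *
  intro i j
  have h1 := (h i j).comp_sub_const t T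
  simpa only [← neg_smul, neg_sub] using h1

theorem hasDerivAt_flow (t : ℝ) :
    HasDerivAt (flow A B ε T σ) (flowDeriv A B ε T σ t) t := by
  have h := hasDerivAt_matrix_mul (hasDerivAt_exp_neg_sub A T t) (hasDerivAt_matM_sub A B ε T σ t)
  have e : A * NormedSpace.exp (-((T - t) • A)) * matM A B ε (T - t) σ +
      NormedSpace.exp (-((T - t) • A)) * -(ε ^ 2 • (NormedSpace.exp ((T - t) • A) * B * Bᵀ *
        NormedSpace.exp ((T - t) • Aᵀ))) = flowDeriv A B ε T σ t := by
    rw [flowDeriv, flow, Matrix.mul_assoc A, mul_neg, ← sub_eq_add_neg, Matrix.mul_smul,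
      ← Matrix.mul_assoc, ← Matrix.mul_assoc, ← Matrix.mul_assoc, ← Matrix.mul_assoc,
      exp_neg_smul_mul_exp_smul,
      Matrix.one_mul]
  exact e ▸ h

@[fun_prop]
theorem continuous_flow : Continuous (flow A B ε T σ) :=
  continuous_iff_continuousAt.2 fun t =>
    continuousAt_of_hasDerivAt_matrix (hasDerivAt_flow A B ε T σ t)

@[fun_prop]
theorem continuous_flowDeriv : Continuous (flowDeriv A B ε T σ) := by
  unfold flowDeriv
  have h : Continuous fun t => NormedSpace.exp ((T - t) • Aᵀ) :=
    (continuous_exp_smul Aᵀ).comp (by fun_prop)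
  fun_prop

variable {σ} {T} in
theorem isUnit_det_flow (hσ : σ ≠ 0) {t : ℝ} (ht : t ≤ T) : IsUnit (flow A B ε T σ t).det := by
  rw [flow, Matrix.det_mul]
  exact (isUnit_det_exp_neg_smul A _).mul
    (isUnit_det_matM A B ε hσ (sub_nonneg.2 ht))

theorem flow_terminal : flow A B ε T σ T = σ ^ 2 • 1 := by
  simp [flow, matM_eq, gramian, matrixIntegral_zero]

/-- The weight `Q_{T-t}` of the feedback law is the fundamental matrix times an invertible
factor. -/
theorem covQ_eq (t : ℝ) :
    covQ A B ε σ (T - t) = flow A B ε T σ t * NormedSpace.exp (-((T - t) • Aᵀ)) := by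
  have h : covSigma A B ε (T - t) = ε ^ 2 • (NormedSpace.exp (-((T - t) • A)) *
      gramian A B (T - t) * NormedSpace.exp (-((T - t) • Aᵀ))) := by
    have key (s : ℝ) : NormedSpace.exp (-((T - t - s) • A)) * B * Bᵀ *
        NormedSpace.exp (-((T - t - s) • Aᵀ)) = NormedSpace.exp (-((T - t) • A)) *
        (NormedSpace.exp (s • A) * B * Bᵀ * NormedSpace.exp (s • Aᵀ)) *
        NormedSpace.exp (-((T - t) • Aᵀ)) := by
      have h1 : NormedSpace.exp (-((T - t - s) • A)) =
          NormedSpace.exp (-((T - t) • A)) * NormedSpace.exp (s • A) := by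
        rw [← neg_smul, ← neg_smul, exp_smul_mul_exp_smul]
        congr 2; ring
      have h2 : NormedSpace.exp (-((T - t - s) • Aᵀ)) =
          NormedSpace.exp (s • Aᵀ) * NormedSpace.exp (-((T - t) • Aᵀ)) := by
        rw [← neg_smul, ← neg_smul, exp_smul_mul_exp_smul]
        congr 2; ring
      simp only [h1, h2, Matrix.mul_assoc]
    rw [gramian, mul_matrixIntegral_mul (by fun_prop), covSigma]
    simp only [key]
  rw [covQ, h, flow, matM_eq]
  simp only [Matrix.mul_add, Matrix.add_mul, Matrix.mul_smul, Matrix.smul_mul, Matrix.mul_one]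
  rw [add_comm]

theorem covQ_inv (t : ℝ) :
    (covQ A B ε σ (T - t))⁻¹ = NormedSpace.exp ((T - t) • Aᵀ) * (flow A B ε T σ t)⁻¹ := by
  rw [covQ_eq, Matrix.mul_inv_rev,
    Matrix.inv_eq_left_inv (exp_smul_mul_exp_neg_smul Aᵀ (T - t))]

end ClosedLoopFlow

/-! ### Pathwise solution of the closed loop -/

section PathwiseSolution

variable {n m : ℕ} (A : Matrix (Fin n) (Fin n) ℝ) (B : Matrix (Fin n) (Fin m) ℝ) (ε T σ : ℝ)
  (x₀ x_f : EuclideanSpace ℝ (Fin n))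

/-- The kernel `F = ε Φ⁻¹ B` against which the noise is integrated in the coordinates
`Φ⁻¹ (x - m)`. -/
def noiseKernel (t : ℝ) : Matrix (Fin n) (Fin m) ℝ :=
  ε • ((flow A B ε T σ t)⁻¹ * B)

/-- The derivative `-ε Φ⁻¹ Φ' Φ⁻¹ B` of `noiseKernel`. -/
def noiseKernelDeriv (t : ℝ) : Matrix (Fin n) (Fin m) ℝ :=
  -(ε • ((flow A B ε T σ t)⁻¹ * flowDeriv A B ε T σ t * (flow A B ε T σ t)⁻¹ * B))

/-- The coordinate `Z_t = Φ_0⁻¹ (x₀ - m_T) + ∫₀ᵗ F dw` of the solution driven by the path `w`. The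
integral is defined by parts, `∫₀ᵗ F dw = F_t w_t - ∫₀ᵗ F' w ds`, so `w` need only be continuous.
The boundary term `F_0 w_0` is not subtracted, because the integral equation is written with
`ε B w_t` rather than with `ε B (w_t - w_0)`. -/
def flowCoord (w : ℝ → EuclideanSpace ℝ (Fin m)) (t : ℝ) : EuclideanSpace ℝ (Fin n) :=
  (flow A B ε T σ 0)⁻¹.toEuclideanLin (x₀ - meanZ A x_f T)
    + (noiseKernel A B ε T σ t).toEuclideanLin (w t)
    - ∫ s in (0 : ℝ)..t, (noiseKernelDeriv A B ε T σ s).toEuclideanLin (w s)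

/-- The solution `X_t = m_{T-t} + Φ_t Z_t` of the closed loop driven by the path `w`. -/
def pathSolution (w : ℝ → EuclideanSpace ℝ (Fin m)) (t : ℝ) : EuclideanSpace ℝ (Fin n) :=
  meanZ A x_f (T - t) + (flow A B ε T σ t).toEuclideanLin (flowCoord A B ε T σ x₀ x_f w t)

theorem hasDerivAt_meanZ_sub (t : ℝ) : HasDerivAt (fun s => meanZ A x_f (T - s))
    (A.toEuclideanLin (meanZ A x_f (T - t))) t := by
  have h := hasDerivAt_toEuclideanLin (hasDerivAt_exp_neg_sub A T t) (hasDerivAt_const t x_f)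
  rwa [map_zero, add_zero, toEuclideanLin_mul_apply] at h

theorem continuous_meanZ_sub : Continuous fun s => meanZ A x_f (T - s) :=
  continuous_iff_continuousAt.2 fun t => (hasDerivAt_meanZ_sub A T x_f t).continuousAt

theorem continuousOn_matrix_mul {X : Type*} [TopologicalSpace X] {s : Set X} {j k l : ℕ}
    {F : X → Matrix (Fin j) (Fin k) ℝ} {G : X → Matrix (Fin k) (Fin l) ℝ}
    (hF : ContinuousOn F s) (hG : ContinuousOn G s) : ContinuousOn (fun x => F x * G x) s :=
  (continuous_fst.matrix_mul continuous_snd).comp_continuousOn (hF.prodMk hG)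

variable {σ}

theorem continuousOn_flow_inv (hσ : σ ≠ 0) :
    ContinuousOn (fun t => (flow A B ε T σ t)⁻¹) (Icc 0 T) := fun t ht =>
  (continuousAt_of_hasDerivAt_matrix (hasDerivAt_matrix_inv (hasDerivAt_flow A B ε T σ t)
    (isUnit_det_flow A B ε hσ ht.2))).continuousWithinAt

theorem hasDerivAt_matrix_const (M : Matrix (Fin n) (Fin m) ℝ) (t : ℝ) :
    HasDerivAt (fun _ : ℝ => M) 0 t :=
  hasDerivAt_matrix_iff.2 fun i j => hasDerivAt_const t (M i j)

theorem hasDerivAt_noiseKernel (hσ : σ ≠ 0) {t : ℝ} (ht : t ≤ T) :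
    HasDerivAt (noiseKernel A B ε T σ) (noiseKernelDeriv A B ε T σ t) t := by
  have h := hasDerivAt_matrix_mul (hasDerivAt_matrix_inv (hasDerivAt_flow A B ε T σ t)
    (isUnit_det_flow A B ε hσ ht)) (hasDerivAt_matrix_const B t)
  rw [hasDerivAt_matrix_iff] at *
  intro i j
  refine ((h i j).const_mul ε).congr_deriv ?_
  simp only [noiseKernelDeriv, Matrix.neg_mul, Matrix.add_apply, Matrix.neg_apply,
    Matrix.smul_apply, smul_eq_mul]
  simp

theorem continuousOn_noiseKernelDeriv (hσ : σ ≠ 0) :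
    ContinuousOn (noiseKernelDeriv A B ε T σ) (Icc 0 T) := by
  have h := continuousOn_flow_inv A B ε T hσ
  exact ((continuousOn_matrix_mul ((h.mul (continuous_flowDeriv A B ε T σ).continuousOn).mul h)
    continuousOn_const).const_smul ε).neg

theorem flow_mul_noiseKernel (hσ : σ ≠ 0) {t : ℝ} (ht : t ≤ T) :
    flow A B ε T σ t * noiseKernel A B ε T σ t = ε • B := by
  rw [noiseKernel, Matrix.mul_smul, Matrix.mul_nonsing_inv_cancel_left _ _
    (isUnit_det_flow A B ε hσ ht)]

theorem flow_mul_noiseKernelDeriv (hσ : σ ≠ 0) {t : ℝ} (ht : t ≤ T) :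
    flow A B ε T σ t * noiseKernelDeriv A B ε T σ t =
      -(flowDeriv A B ε T σ t * noiseKernel A B ε T σ t) := by
  rw [noiseKernel, noiseKernelDeriv, Matrix.mul_neg, Matrix.mul_smul, Matrix.mul_smul]
  simp only [Matrix.mul_assoc]
  rw [Matrix.mul_nonsing_inv_cancel_left _ _ (isUnit_det_flow A B ε hσ ht)]

/-- Around the moving centre `m_{T-t}`, which follows the uncontrolled dynamics, the closed-loop
drift is linear with coefficient `Φ' Φ⁻¹`. -/
theorem drift_eq (hσ : σ ≠ 0) {t : ℝ} (ht : t ≤ T) (x : EuclideanSpace ℝ (Fin n)) :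
    A.toEuclideanLin x + B.toEuclideanLin (feedback A B ε T x_f σ t x) =
      A.toEuclideanLin (meanZ A x_f (T - t)) +
        (flowDeriv A B ε T σ t * (flow A B ε T σ t)⁻¹).toEuclideanLin
          (x - meanZ A x_f (T - t)) := by
  have h : flowDeriv A B ε T σ t * (flow A B ε T σ t)⁻¹ =
      A - ε ^ 2 • (B * (Bᵀ * (covQ A B ε σ (T - t))⁻¹)) := by
    rw [flowDeriv, Matrix.sub_mul, Matrix.mul_nonsing_inv_cancel_right _ _
      (isUnit_det_flow A B ε hσ ht), covQ_inv, Matrix.smul_mul]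
    simp only [Matrix.mul_assoc]
  rw [h, feedback]
  simp only [map_sub, LinearMap.sub_apply, map_neg, map_smul, LinearMap.smul_apply,
    toEuclideanLin_mul_apply, smul_sub]
  abel

/-- A primitive defined beyond `[0, T]`, so that it has two-sided derivatives at the endpoints
too. -/
theorem exists_primitive {E : Type*} [NormedAddCommGroup E] [NormedSpace ℝ E] [CompleteSpace E]
    {T : ℝ} (hT : 0 ≤ T) {g : ℝ → E} (hg : ContinuousOn g (Icc 0 T)) :
    ∃ G : ℝ → E, (∀ t ∈ Icc 0 T, HasDerivAt G (g t) t) ∧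
      ∀ t ∈ Icc 0 T, ∫ s in (0 : ℝ)..t, g s = G t := by
  have h : Continuous (IccExtend hT ((Icc 0 T).domRestrict g)) := hg.domRestrict.Icc_extend'
  have e : ∀ t ∈ Icc 0 T, IccExtend hT ((Icc 0 T).domRestrict g) t = g t := fun t ht => by
    rw [IccExtend_of_mem hT _ ht, domRestrict_apply]
  refine ⟨fun t => ∫ s in (0 : ℝ)..t, IccExtend hT ((Icc 0 T).domRestrict g) s, fun t ht => ?_,
    fun t ht => ?_⟩
  · rw [← e t ht]
    exact (h.integral_hasStrictDerivAt 0 t).hasDerivAt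
  · refine intervalIntegral.integral_congr fun s hs => ?_
    rw [uIcc_of_le ht.1] at hs
    exact (e s ⟨hs.1, hs.2.trans ht.2⟩).symm

theorem continuousOn_flowDeriv_mul_flow_inv (hσ : σ ≠ 0) :
    ContinuousOn (fun t => flowDeriv A B ε T σ t * (flow A B ε T σ t)⁻¹) (Icc 0 T) :=
  (continuous_flowDeriv A B ε T σ).continuousOn.mul (continuousOn_flow_inv A B ε T hσ)

theorem continuousOn_drift (hσ : σ ≠ 0) {x : ℝ → EuclideanSpace ℝ (Fin n)}
    (hx : ContinuousOn x (Icc 0 T)) :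
    ContinuousOn (fun s => A.toEuclideanLin (x s) +
      B.toEuclideanLin (feedback A B ε T x_f σ s (x s))) (Icc 0 T) := by
  have hm := (continuous_meanZ_sub A T x_f).continuousOn (s := Icc 0 T)
  have h : ContinuousOn (fun s => A.toEuclideanLin (meanZ A x_f (T - s)) +
        (flowDeriv A B ε T σ s * (flow A B ε T σ s)⁻¹).toEuclideanLin
          (x s - meanZ A x_f (T - s))) (Icc 0 T) :=
    (continuousOn_toEuclideanLin continuousOn_const hm).add
      (continuousOn_toEuclideanLin (continuousOn_flowDeriv_mul_flow_inv A B ε T hσ) (hx.sub hm))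
  exact h.congr fun s hs => drift_eq A B ε T x_f hσ hs.2 (x s)

/-- Existence, for each driving path. The noise terms cancel in `X - ε B w` because
`Φ F = ε B` is constant, so this difference is continuously differentiable and it suffices to
compute its derivative. -/
theorem pathSolution_spec (hσ : σ ≠ 0) (hT : 0 ≤ T) {w : ℝ → EuclideanSpace ℝ (Fin m)}
    (hw : Continuous w) :
    ContinuousOn (pathSolution A B ε T σ x₀ x_f w) (Icc 0 T) ∧
    ∀ t ∈ Icc 0 T, pathSolution A B ε T σ x₀ x_f w t = x₀
      + (∫ s in (0 : ℝ)..t, (A.toEuclideanLin (pathSolution A B ε T σ x₀ x_f w s)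
        + B.toEuclideanLin (feedback A B ε T x_f σ s (pathSolution A B ε T σ x₀ x_f w s))))
      + ε • B.toEuclideanLin (w t) := by
  obtain ⟨G, hG, hGe⟩ := exists_primitive hT
    (continuousOn_toEuclideanLin (continuousOn_noiseKernelDeriv A B ε T hσ) hw.continuousOn)
  set c := (flow A B ε T σ 0)⁻¹.toEuclideanLin (x₀ - meanZ A x_f T) with hc
  set V : ℝ → EuclideanSpace ℝ (Fin n) := fun t =>
    meanZ A x_f (T - t) + (flow A B ε T σ t).toEuclideanLin (c - G t) with hV
  have hVd : ∀ t ∈ Icc 0 T, HasDerivAt V (A.toEuclideanLin (meanZ A x_f (T - t)) +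
      (flowDeriv A B ε T σ t).toEuclideanLin
        (c - G t + (noiseKernel A B ε T σ t).toEuclideanLin (w t))) t := by
    intro t ht
    have h := (hasDerivAt_meanZ_sub A T x_f t).add
      (hasDerivAt_toEuclideanLin (hasDerivAt_flow A B ε T σ t) ((hG t ht).const_sub c))
    refine h.congr_deriv ?_
    rw [map_neg, ← toEuclideanLin_mul_apply, flow_mul_noiseKernelDeriv A B ε T hσ ht.2,
      map_neg, LinearMap.neg_apply, neg_neg, toEuclideanLin_mul_apply, ← map_add]
  have hX : ∀ t ∈ Icc 0 T,
      pathSolution A B ε T σ x₀ x_f w t = V t + ε • B.toEuclideanLin (w t) := by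
    intro t ht
    rw [pathSolution, flowCoord, hGe t ht, ← hc, add_sub_right_comm, map_add,
      ← toEuclideanLin_mul_apply, flow_mul_noiseKernel A B ε T hσ ht.2, map_smul,
      LinearMap.smul_apply, ← add_assoc]
  have hVdrift : ∀ t ∈ Icc 0 T, HasDerivAt V
      (A.toEuclideanLin (pathSolution A B ε T σ x₀ x_f w t) +
        B.toEuclideanLin (feedback A B ε T x_f σ t (pathSolution A B ε T σ x₀ x_f w t))) t := by
    intro t ht
    refine (hVd t ht).congr_deriv ?_
    rw [drift_eq A B ε T x_f hσ ht.2, pathSolution, add_sub_cancel_left,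
      ← toEuclideanLin_mul_apply, Matrix.nonsing_inv_mul_cancel_right _ _
        (isUnit_det_flow A B ε hσ ht.2), flowCoord, hGe t ht, ← hc, add_sub_right_comm]
  have hcont : ContinuousOn (pathSolution A B ε T σ x₀ x_f w) (Icc 0 T) := by
    have h : ContinuousOn V (Icc 0 T) := fun t ht => (hVd t ht).continuousAt.continuousWithinAt
    refine (h.add ((continuousOn_toEuclideanLin continuousOn_const
      hw.continuousOn).const_smul ε)).congr hX
  refine ⟨hcont, fun t ht => ?_⟩
  have hV0 : V 0 = x₀ := by
    have hG0 : G 0 = 0 := by rw [← hGe 0 ⟨le_rfl, hT⟩, intervalIntegral.integral_same]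
    simp only [hV, hG0, sub_zero]
    rw [hc, ← toEuclideanLin_mul_apply, Matrix.mul_nonsing_inv _ (isUnit_det_flow A B ε hσ hT),
      toEuclideanLin_one_apply, add_sub_cancel]
  rw [intervalIntegral.integral_eq_sub_of_hasDerivAt (f := V), hV0, hX t ht, add_sub_cancel]
  · intro s hs
    rw [uIcc_of_le ht.1] at hs
    exact hVdrift s ⟨hs.1, hs.2.trans ht.2⟩
  · exact ((continuousOn_drift A B ε T x_f hσ hcont).mono
      (Icc_subset_Icc_right ht.2)).intervalIntegrable_of_Icc ht.1

/-- Uniqueness: the noise drops out of the difference of two solutions, which therefore solves a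
linear ordinary differential equation with continuous coefficient and zero initial value. -/
theorem path_unique (hσ : σ ≠ 0) (hT : 0 ≤ T) {w : ℝ → EuclideanSpace ℝ (Fin m)}
    {x y : ℝ → EuclideanSpace ℝ (Fin n)}
    (hx : ContinuousOn x (Icc 0 T)) (hy : ContinuousOn y (Icc 0 T))
    (hxe : ∀ t ∈ Icc 0 T, x t = x₀ + (∫ s in (0 : ℝ)..t, (A.toEuclideanLin (x s)
        + B.toEuclideanLin (feedback A B ε T x_f σ s (x s)))) + ε • B.toEuclideanLin (w t))
    (hye : ∀ t ∈ Icc 0 T, y t = x₀ + (∫ s in (0 : ℝ)..t, (A.toEuclideanLin (y s)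
        + B.toEuclideanLin (feedback A B ε T x_f σ s (y s)))) + ε • B.toEuclideanLin (w t)) :
    ∀ t ∈ Icc 0 T, x t = y t := by
  obtain ⟨G, hG, hGe⟩ := exists_primitive hT (continuousOn_drift A B ε T x_f hσ hx)
  obtain ⟨H, hH, hHe⟩ := exists_primitive hT (continuousOn_drift A B ε T x_f hσ hy)
  have hsub : ∀ t ∈ Icc 0 T, x t - y t = G t - H t := by
    intro t ht
    rw [hxe t ht, hye t ht, hGe t ht, hHe t ht]
    abel
  obtain ⟨C, hC⟩ := isCompact_Icc.exists_bound_of_continuousOn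
    (f := fun t => Matrix.toEuclideanCLM (𝕜 := ℝ)
      (flowDeriv A B ε T σ t * (flow A B ε T σ t)⁻¹))
    ((LinearMap.continuous_of_finiteDimensional
      (Matrix.toEuclideanCLM (n := Fin n) (𝕜 := ℝ)).toAlgEquiv.toLinearMap).comp_continuousOn
        (continuousOn_flowDeriv_mul_flow_inv A B ε T hσ))
  have h0 := eq_zero_of_abs_deriv_le_mul_abs_self_of_eq_zero_right (f := fun t => G t - H t)
    (a := 0) (b := T) (K := C)
    (fun t ht => ((hG t ht).sub (hH t ht)).continuousAt.continuousWithinAt)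
    (fun t ht => ((hG t ⟨ht.1, ht.2.le⟩).sub (hH t ⟨ht.1, ht.2.le⟩)).hasDerivWithinAt)
    (by rw [← hGe 0 ⟨le_rfl, hT⟩, ← hHe 0 ⟨le_rfl, hT⟩]; simp) (by
      intro t ht
      have ht' : t ∈ Icc 0 T := ⟨ht.1, ht.2.le⟩
      rw [drift_eq A B ε T x_f hσ ht'.2, drift_eq A B ε T x_f hσ ht'.2, add_sub_add_left_eq_sub,
        ← map_sub, sub_sub_sub_cancel_right, ← hsub t ht']
      exact (Matrix.toEuclideanCLM (𝕜 := ℝ)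
        (flowDeriv A B ε T σ t * (flow A B ε T σ t)⁻¹)).le_of_opNorm_le (hC t ht') _)
  intro t ht
  rw [← sub_eq_zero, hsub t ht, h0 t ht]

end PathwiseSolution

/-! ### Joint measurability -/

section JointMeasurability

/-- A process has a version on `[0, t]` which agrees with it along every continuous path and is
jointly measurable for any `σ`-algebra that makes the values up to time `t` measurable. The
exceptional set of discontinuous paths need not belong to that `σ`-algebra. The version is the upper
limit of the piecewise constant approximations; sampling to the left keeps it non-anticipating. -/
theorem exists_measurable_uncurry_of_continuous {Ω : Type*} {mΩ : MeasurableSpace Ω} {t : ℝ}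
    {w : ℝ≥0 → Ω → ℝ} (hw : ∀ s ≤ t.toNNReal, Measurable (w s)) :
    ∃ v : ℝ → Ω → ℝ, Measurable (Function.uncurry v) ∧
      ∀ ω, Continuous (fun s => w s ω) → ∀ s ∈ Icc 0 t, v s ω = w s.toNNReal ω := by
  -- The minimum with `t` also keeps the sample times inside `[0, t]` when `s > t`.
  let q : ℕ → ℝ → ℝ≥0 := fun n s => (min ((⌊s * n⌋₊ : ℝ) / n) t).toNNReal
  refine ⟨fun s ω => Filter.limsup (fun n : ℕ => w (q n s) ω) Filter.atTop, ?_, ?_⟩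
  · refine Measurable.limsup (f := fun (n : ℕ) (p : ℝ × Ω) => w (q n p.1) p.2) fun n => ?_
    have h1 : Measurable fun p : ℕ × Ω => w (min ((p.1 : ℝ) / n) t).toNNReal p.2 :=
      measurable_from_prod_countable_right fun k =>
        hw (min ((k : ℝ) / n) t).toNNReal (Real.toNNReal_le_toNNReal (min_le_right _ _))
    have h2 : Measurable fun p : ℝ × Ω => (⌊p.1 * n⌋₊, p.2) :=
      (Nat.measurable_floor.comp (measurable_fst.mul_const _)).prodMk measurable_snd
    exact h1.comp h2
  · intro ω hω s hs
    refine Filter.Tendsto.limsup_eq ?_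
    have h : Filter.Tendsto (fun n : ℕ => q n s) Filter.atTop (nhds s.toNNReal) := by
      have h1 := ((tendsto_nat_floor_mul_div_atTop hs.1).comp tendsto_natCast_atTop_atTop).min
        (tendsto_const_nhds (x := t))
      rw [min_eq_left hs.2] at h1
      exact (continuous_real_toNNReal.tendsto s).comp h1
    exact (hω.tendsto _).comp h

end JointMeasurability

/-! ### Mean-square integrals of second-order processes -/

section WienerIntegral

variable {Ω : Type*} {mΩ : MeasurableSpace Ω} {P : Measure Ω} [IsProbabilityMeasure P] {T : ℝ}

/-- A jointly measurable process whose second moments on `[0, T]` are finite and bounded by `T`, the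
bound satisfied by Brownian motion. -/
structure IsSecondOrder (V : ℝ → Ω → ℝ) (P : Measure Ω) (T : ℝ) : Prop where
  measurable : Measurable (Function.uncurry V)
  memLp : ∀ s ∈ Icc 0 T, MemLp (V s) 2 P
  integral_sq_le : ∀ s ∈ Icc 0 T, ∫ ω, V s ω ^ 2 ∂P ≤ T

theorem aestronglyMeasurable_weight {g : ℝ → ℝ} (hg : ContinuousOn g (Icc 0 T)) :
    AEStronglyMeasurable g (volume.restrict (Ioc 0 T)) :=
  (hg.mono Ioc_subset_Icc_self).aestronglyMeasurable measurableSet_Ioc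

theorem IsSecondOrder.integrable_weight_mul {V : ℝ → Ω → ℝ} (hV : IsSecondOrder V P T)
    {g : ℝ → ℝ} (hg : ContinuousOn g (Icc 0 T)) {Y : Ω → ℝ} (hY : MemLp Y 2 P) :
    Integrable (Function.uncurry fun s ω => g s * (Y ω * V s ω))
      ((volume.restrict (Ioc 0 T)).prod P) := by
  have hm : AEStronglyMeasurable (Function.uncurry fun s ω => g s * (Y ω * V s ω))
      ((volume.restrict (Ioc 0 T)).prod P) :=
    (aestronglyMeasurable_weight hg).comp_fst.mul
      (hY.1.comp_snd.mul hV.measurable.aestronglyMeasurable)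
  obtain ⟨C, hC⟩ := isCompact_Icc.exists_bound_of_continuousOn hg
  rw [integrable_prod_iff hm]
  constructor
  · filter_upwards [ae_restrict_mem measurableSet_Ioc] with s hs
    exact (hY.integrable_mul (hV.memLp s (Ioc_subset_Icc_self hs))).const_mul (g s)
  · refine Integrable.of_bound hm.norm.integral_prod_right' (C * (∫ ω, Y ω ^ 2 ∂P + T)) ?_
    filter_upwards [ae_restrict_mem measurableSet_Ioc] with s hs
    have hs' := Ioc_subset_Icc_self hs
    rw [Real.norm_of_nonneg (integral_nonneg fun _ => norm_nonneg _)]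
    simp only [Function.uncurry, norm_mul]
    rw [integral_const_mul]
    have hVs := hV.memLp s hs'
    refine mul_le_mul (hC s hs') ?_ (integral_nonneg fun _ => by positivity)
      ((norm_nonneg _).trans (hC s hs'))
    calc ∫ ω, ‖Y ω‖ * ‖V s ω‖ ∂P ≤ ∫ ω, (Y ω ^ 2 + V s ω ^ 2) ∂P := by
          refine integral_mono ?_ (hY.integrable_sq.add hVs.integrable_sq) fun ω => ?_
          · exact (hY.norm.integrable_mul hVs.norm)
          · simp only [Real.norm_eq_abs]
            rw [← sq_abs (Y ω), ← sq_abs (V s ω)]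
            nlinarith [sq_nonneg (|Y ω| - |V s ω|), sq_nonneg (|Y ω|), sq_nonneg (|V s ω|)]
      _ = ∫ ω, Y ω ^ 2 ∂P + ∫ ω, V s ω ^ 2 ∂P :=
          integral_add hY.integrable_sq hVs.integrable_sq
      _ ≤ _ := by gcongr; exact hV.integral_sq_le s hs'

/-- Fubini: the expectation against `Y` commutes with the time integral. -/
theorem IsSecondOrder.integral_mul_integral (hT : 0 ≤ T) {V : ℝ → Ω → ℝ}
    (hV : IsSecondOrder V P T) {g : ℝ → ℝ} (hg : ContinuousOn g (Icc 0 T)) {Y : Ω → ℝ}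
    (hY : MemLp Y 2 P) :
    ∫ ω, Y ω * (∫ s in (0 : ℝ)..T, g s * V s ω) ∂P =
      ∫ s in (0 : ℝ)..T, g s * ∫ ω, Y ω * V s ω ∂P := by
  have h := integral_integral_swap (hV.integrable_weight_mul hg hY)
  simp only [intervalIntegral.integral_of_le hT]
  rw [← funext fun s => integral_const_mul (g s) fun ω => Y ω * V s ω, h]
  congr with ω
  rw [← integral_const_mul]
  congr with s
  ring

/-- The Cauchy–Schwarz inequality against the constant function `1` on `[0, T]`. -/
theorem sq_integral_le {u : ℝ → ℝ} (hT : 0 ≤ T) (hu : MemLp u 2 (volume.restrict (Ioc 0 T))) :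
    (∫ s in Ioc 0 T, u s) ^ 2 ≤ T * ∫ s in Ioc 0 T, u s ^ 2 := by
  rcases hT.eq_or_lt with rfl | hT
  · simp
  have hi := hu.integrable (by norm_num)
  -- `T` times the mean of `u` is `∫ u`, so this is the positivity of a variance, scaled by `T²`.
  have h : 0 ≤ ∫ s in Ioc 0 T, (T * u s - ∫ r in Ioc 0 T, u r) ^ 2 :=
    integral_nonneg fun _ => sq_nonneg _
  set a := ∫ r in Ioc 0 T, u r with ha
  have e : ∫ s in Ioc 0 T, (T * u s - a) ^ 2 =
      T * (T * (∫ s in Ioc 0 T, u s ^ 2) - a ^ 2) := by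
    have e1 : (fun s => (T * u s - a) ^ 2) =
        fun s => T ^ 2 * u s ^ 2 - 2 * T * a * u s + a ^ 2 := by ext; ring
    have i1 := hu.integrable_sq.const_mul (T ^ 2)
    have i2 := hi.const_mul (2 * T * a)
    rw [e1, integral_add (f := fun s => T ^ 2 * u s ^ 2 - 2 * T * a * u s)
      (i1.sub i2) (integrable_const _), integral_sub i1 i2,
      integral_const_mul, integral_const_mul, ← ha]
    simp [hT.le]
    ring
  rw [e] at h
  nlinarith [nonneg_of_mul_nonneg_right h hT]

theorem IsSecondOrder.memLp_integral (hT : 0 ≤ T) {V : ℝ → Ω → ℝ}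
    (hV : IsSecondOrder V P T) {g : ℝ → ℝ} (hg : ContinuousOn g (Icc 0 T)) :
    MemLp (fun ω => ∫ s in (0 : ℝ)..T, g s * V s ω) 2 P := by
  have hm : AEStronglyMeasurable (fun p : ℝ × Ω => g p.1 * V p.1 p.2)
      ((volume.restrict (Ioc 0 T)).prod P) :=
    (aestronglyMeasurable_weight hg).comp_fst.mul hV.measurable.aestronglyMeasurable
  obtain ⟨C, hC⟩ := isCompact_Icc.exists_bound_of_continuousOn hg
  have hsq : Integrable (fun p : ℝ × Ω => (g p.1 * V p.1 p.2) ^ 2)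
      ((volume.restrict (Ioc 0 T)).prod P) := by
    have hm2 : AEStronglyMeasurable (fun p : ℝ × Ω => (g p.1 * V p.1 p.2) ^ 2)
      ((volume.restrict (Ioc 0 T)).prod P) := hm.pow 2
    rw [integrable_prod_iff hm2]
    constructor
    · filter_upwards [ae_restrict_mem measurableSet_Ioc] with s hs
      simp only [mul_pow]
      exact (hV.memLp s (Ioc_subset_Icc_self hs)).integrable_sq.const_mul _
    · refine Integrable.of_bound hm2.norm.integral_prod_right' (C ^ 2 * T) ?_
      filter_upwards [ae_restrict_mem measurableSet_Ioc] with s hs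
      have hs' := Ioc_subset_Icc_self hs
      rw [Real.norm_of_nonneg (integral_nonneg fun _ => norm_nonneg _)]
      simp only [norm_pow, mul_pow, norm_mul, Real.norm_eq_abs, sq_abs]
      rw [integral_const_mul]
      refine mul_le_mul ?_ (hV.integral_sq_le s hs') (integral_nonneg fun _ => by positivity)
        (by positivity)
      exact sq_le_sq' (abs_le.1 (hC s hs')).1 (abs_le.1 (hC s hs')).2
  simp only [intervalIntegral.integral_of_le hT]
  have hmI : AEStronglyMeasurable (fun ω => ∫ s in Ioc 0 T, g s * V s ω) P :=
    hm.prod_swap.integral_prod_right'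
  rw [memLp_two_iff_integrable_sq hmI]
  refine (hsq.integral_prod_right.const_mul T).mono' (hmI.pow 2) ?_
  filter_upwards [hsq.prod_left_ae, hm.prod_swap.prodMk_left] with ω hω hmω
  rw [Real.norm_of_nonneg (sq_nonneg _)]
  exact sq_integral_le hT ((memLp_two_iff_integrable_sq hmω).2 hω)

end WienerIntegral

/-! ### Wiener integrals and the Itô isometry -/

section Isometry

variable {Ω : Type*} {mΩ : MeasurableSpace Ω} {P : Measure Ω} [IsProbabilityMeasure P] {T : ℝ}

/-- The Wiener integral `∫₀ᵀ f dV` of a continuously differentiable `f`, defined pathwise by parts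
as `f(T) V_T - ∫₀ᵀ f' V ds`. The function `f'` is meant to be the derivative of `f`, and the formula
is for processes with `V_0 = 0`. -/
def wienerIntegral (f f' : ℝ → ℝ) (T : ℝ) (V : ℝ → Ω → ℝ) (ω : Ω) : ℝ :=
  f T * V T ω - ∫ s in (0 : ℝ)..T, f' s * V s ω

/-- Integration by parts against the covariance `min r s` of Brownian motion. This is the covariance
of `∫₀ᵀ f dV` with `V_s`. -/
theorem integral_deriv_mul_min {f f' : ℝ → ℝ} (hf : ∀ t ∈ Icc 0 T, HasDerivAt f (f' t) t)
    (hf' : ContinuousOn f' (Icc 0 T)) {s : ℝ} (hs : s ∈ Icc 0 T) :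
    f T * s - ∫ r in (0 : ℝ)..T, f' r * min r s = ∫ r in (0 : ℝ)..s, f r := by
  have hi1 : IntervalIntegrable f' volume 0 s :=
    (hf'.mono (Icc_subset_Icc_right hs.2)).intervalIntegrable_of_Icc hs.1
  have hi2 : IntervalIntegrable f' volume s T :=
    (hf'.mono (Icc_subset_Icc_left hs.1)).intervalIntegrable_of_Icc hs.2
  have hmin : Continuous fun r : ℝ => min r s := by fun_prop
  rw [← intervalIntegral.integral_add_adjacent_intervals
    (hi1.mul_continuousOn hmin.continuousOn) (hi2.mul_continuousOn hmin.continuousOn)]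
  have e1 : ∫ r in (0 : ℝ)..s, f' r * min r s = s * f s - ∫ r in (0 : ℝ)..s, f r := by
    have h := intervalIntegral.integral_mul_deriv_eq_deriv_mul (a := 0) (b := s) (u := fun r => r)
      (u' := fun _ => 1) (v := f) (v' := f') (fun x _ => hasDerivAt_id x)
      (fun x hx => by
        rw [uIcc_of_le hs.1] at hx
        exact hf x ⟨hx.1, hx.2.trans hs.2⟩) (by simp) hi1
    simp only [zero_mul, sub_zero, one_mul] at h
    rw [← h]
    refine intervalIntegral.integral_congr fun r hr => ?_
    rw [uIcc_of_le hs.1] at hr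
    simp only [min_eq_left hr.2, mul_comm]
  have e2 : ∫ r in s..T, f' r * min r s = (f T - f s) * s := by
    rw [← intervalIntegral.integral_eq_sub_of_hasDerivAt (f := f) (f' := f') _ hi2,
      ← intervalIntegral.integral_mul_const]
    · refine intervalIntegral.integral_congr fun r hr => ?_
      rw [uIcc_of_le hs.2] at hr
      simp only [min_eq_right hr.1]
    · intro x hx
      rw [uIcc_of_le hs.2] at hx
      exact hf x ⟨hs.1.trans hx.1, hx.2⟩
  rw [e1, e2]
  ring

theorem IsSecondOrder.memLp_wienerIntegral (hT : 0 ≤ T) {V : ℝ → Ω → ℝ}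
    (hV : IsSecondOrder V P T) {f f' : ℝ → ℝ} (hf' : ContinuousOn f' (Icc 0 T)) :
    MemLp (wienerIntegral f f' T V) 2 P :=
  ((hV.memLp T ⟨hT, le_rfl⟩).const_mul (f T)).sub (hV.memLp_integral hT hf')

theorem IsSecondOrder.integral_mul_wienerIntegral (hT : 0 ≤ T) {V : ℝ → Ω → ℝ}
    (hV : IsSecondOrder V P T) {f f' : ℝ → ℝ} (hf' : ContinuousOn f' (Icc 0 T)) {Y : Ω → ℝ}
    (hY : MemLp Y 2 P) :
    ∫ ω, Y ω * wienerIntegral f f' T V ω ∂P = f T * (∫ ω, Y ω * V T ω ∂P)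
      - ∫ s in (0 : ℝ)..T, f' s * ∫ ω, Y ω * V s ω ∂P := by
  have i1 : Integrable (fun ω => f T * (Y ω * V T ω)) P :=
    (hY.integrable_mul (hV.memLp T ⟨hT, le_rfl⟩)).const_mul (f T)
  have i2 : Integrable (fun ω => Y ω * ∫ s in (0 : ℝ)..T, f' s * V s ω) P :=
    hY.integrable_mul (hV.memLp_integral hT hf')
  rw [← hV.integral_mul_integral hT hf' hY, ← integral_const_mul, ← integral_sub i1 i2]
  congr with ω
  rw [wienerIntegral]
  ring

theorem integral_wienerIntegral_eq_zero (hT : 0 ≤ T) {V : ℝ → Ω → ℝ}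
    (hV : IsSecondOrder V P T) (hV0 : ∀ s ∈ Icc 0 T, ∫ ω, V s ω ∂P = 0) {f f' : ℝ → ℝ}
    (hf' : ContinuousOn f' (Icc 0 T)) : ∫ ω, wienerIntegral f f' T V ω ∂P = 0 := by
  have h := hV.integral_mul_wienerIntegral (f := f) hT hf' (memLp_const (1 : ℝ))
  simp only [one_mul] at h
  rw [h, hV0 T ⟨hT, le_rfl⟩, intervalIntegral.integral_congr (g := fun _ => 0)]
  · simp
  · intro s hs
    rw [uIcc_of_le hT] at hs
    simp only [hV0 s hs, mul_zero]

/-- The Itô isometry for Wiener integrals. Only the covariance `κ min(s, t)` enters: `κ = 1` for one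
Brownian motion, `κ = 0` for two independent ones. -/
theorem integral_wienerIntegral_mul_wienerIntegral (hT : 0 ≤ T) {U V : ℝ → Ω → ℝ}
    (hU : IsSecondOrder U P T) (hV : IsSecondOrder V P T) {κ : ℝ}
    (hUV : ∀ s ∈ Icc 0 T, ∀ t ∈ Icc 0 T, ∫ ω, U s ω * V t ω ∂P = κ * min s t)
    {f f' g g' : ℝ → ℝ} (hf : ∀ t ∈ Icc 0 T, HasDerivAt f (f' t) t)
    (hf' : ContinuousOn f' (Icc 0 T)) (hg : ∀ t ∈ Icc 0 T, HasDerivAt g (g' t) t)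
    (hg' : ContinuousOn g' (Icc 0 T)) :
    ∫ ω, wienerIntegral f f' T U ω * wienerIntegral g g' T V ω ∂P =
      κ * ∫ s in (0 : ℝ)..T, f s * g s := by
  have hTm : T ∈ Icc 0 T := ⟨hT, le_rfl⟩
  have key : ∀ s ∈ Icc 0 T, ∫ ω, wienerIntegral f f' T U ω * V s ω ∂P =
      κ * ∫ r in (0 : ℝ)..s, f r := by
    intro s hs
    rw [← integral_deriv_mul_min hf hf' hs]
    simp_rw [mul_comm (wienerIntegral f f' T U _)]
    rw [hU.integral_mul_wienerIntegral hT hf' (hV.memLp s hs), mul_sub,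
      ← intervalIntegral.integral_const_mul]
    simp_rw [mul_comm (V s _)]
    rw [hUV T hTm s hs, min_eq_right hs.2]
    congr 1
    · ring
    · refine intervalIntegral.integral_congr fun r hr => ?_
      rw [uIcc_of_le hT] at hr
      simp only [hUV r hr s hs]
      ring
  rw [hV.integral_mul_wienerIntegral hT hg' (hU.memLp_wienerIntegral hT hf'), key T hTm,
    intervalIntegral.integral_congr
      (f := fun s => g' s * ∫ ω, wienerIntegral f f' T U ω * V s ω ∂P)
      (g := fun s => κ * (g' s * ∫ r in (0 : ℝ)..s, f r)),
    intervalIntegral.integral_const_mul]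
  · obtain ⟨F, hF, hFe⟩ := exists_primitive hT
      (g := f) (fun t ht => (hf t ht).continuousAt.continuousWithinAt)
    have h := intervalIntegral.integral_mul_deriv_eq_deriv_mul (a := 0) (b := T)
      (u := F) (u' := f) (v := g) (v' := g')
      (by rw [uIcc_of_le hT]; exact hF) (by rw [uIcc_of_le hT]; exact hg)
      (ContinuousOn.intervalIntegrable_of_Icc hT
        fun t ht => (hf t ht).continuousAt.continuousWithinAt)
      (hg'.intervalIntegrable_of_Icc hT)
    rw [← hFe 0 ⟨le_rfl, hT⟩, intervalIntegral.integral_same, zero_mul, sub_zero] at h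
    rw [hFe T hTm, intervalIntegral.integral_congr (f := fun s => g' s * ∫ r in (0 : ℝ)..s, f r)
      (g := fun s => F s * g' s), h]
    · ring
    · intro s hs
      rw [uIcc_of_le hT] at hs
      simp only [hFe s hs, mul_comm]
  · intro s hs
    rw [uIcc_of_le hT] at hs
    simp only [key s hs]
    ring

end Isometry

/-! ### Moments and versions of the Wiener process -/

section Wiener

variable {m : ℕ} {Ω : Type*} {mΩ : MeasurableSpace Ω} {P : Measure Ω}
  {W : ℝ≥0 → Ω → EuclideanSpace ℝ (Fin m)}

theorem IsWiener.pastSigma_le (hW : IsWiener W P) (t : ℝ≥0) : pastSigma W t ≤ mΩ :=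
  iSup_le fun s => (hW.measurable s).comap_le

theorem measurable_pastSigma_coord {s t : ℝ≥0} (hst : s ≤ t) (j : Fin m) :
    Measurable[pastSigma W t] (fun ω => W s ω j) := by
  have h : Measurable[pastSigma W t] (W s) := by
    rw [measurable_iff_comap_le]
    exact le_iSup (fun s : Iic t => MeasurableSpace.comap (W s) inferInstance) ⟨s, hst⟩
  exact (by fun_prop : Measurable fun x : EuclideanSpace ℝ (Fin m) => x j).comp h

theorem IsWiener.memLp (hW : IsWiener W P) (t : ℝ≥0) (j : Fin m) :
    MemLp (fun ω => W t ω j) 2 P :=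
  ((hW.brownian j).hasLaw_eval t).hasGaussianLaw.memLp_two

theorem IsWiener.integral_eq_zero (hW : IsWiener W P) (t : ℝ≥0) (j : Fin m) :
    ∫ ω, W t ω j ∂P = 0 :=
  (hW.brownian j).integral_eval t

theorem IsWiener.integral_mul [IsProbabilityMeasure P] (hW : IsWiener W P) (s t : ℝ≥0)
    (j k : Fin m) :
    ∫ ω, W s ω j * W t ω k ∂P = (if j = k then 1 else 0) * min (s : ℝ) t := by
  split_ifs with h
  · subst h
    have h1 := (hW.brownian j).covariance_fun_eval s t
    rw [covariance_eq_sub (hW.memLp s j) (hW.memLp t j), hW.integral_eq_zero, zero_mul,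
      sub_zero] at h1
    rw [one_mul]
    simpa using h1
  · have h1 : IndepFun (fun ω => W s ω j) (fun ω => W t ω k) P :=
      (hW.indep.indepFun h).comp (measurable_pi_apply s) (measurable_pi_apply t)
    have h2 := h1.integral_mul_eq_mul_integral (hW.memLp s j).1 (hW.memLp t k).1
    rw [hW.integral_eq_zero, zero_mul] at h2
    rw [zero_mul]
    exact h2

theorem IsWiener.ae_continuous (hW : IsWiener W P) : ∀ᵐ ω ∂P, Continuous fun t => W t ω := by
  filter_upwards [ae_all_iff.2 fun j => (hW.brownian j).cont] with ω h
  exact (PiLp.continuous_toLp 2 _).comp (continuous_pi h)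

theorem IsWiener.exists_version (hW : IsWiener W P) (T : ℝ) :
    ∃ v : Fin m → ℝ → Ω → ℝ,
      (∀ j, Measurable[MeasurableSpace.prod inferInstance (pastSigma W T.toNNReal)]
        (Function.uncurry (v j))) ∧
      ∀ᵐ ω ∂P, ∀ j, ∀ s ∈ Icc 0 T, v j s ω = W s.toNNReal ω j := by
  choose v hv hve using fun j : Fin m =>
    exists_measurable_uncurry_of_continuous (mΩ := pastSigma W T.toNNReal) (t := T)
      (w := fun s ω => W s ω j) fun s hs => measurable_pastSigma_coord hs j
  refine ⟨v, hv, ?_⟩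
  filter_upwards [ae_all_iff.2 fun j => (hW.brownian j).cont] with ω h j s hs
  exact hve j ω (h j) s hs

theorem IsWiener.exists_secondOrder [IsProbabilityMeasure P] (hW : IsWiener W P) (T : ℝ) :
    ∃ v : Fin m → ℝ → Ω → ℝ,
      (∀ j, IsSecondOrder (v j) P T) ∧
      (∀ j, ∀ s ∈ Icc 0 T, ∫ ω, v j s ω ∂P = 0) ∧
      (∀ j k, ∀ s ∈ Icc 0 T, ∀ t ∈ Icc 0 T,
        ∫ ω, v j s ω * v k t ω ∂P = (if j = k then 1 else 0) * min s t) ∧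
      ∀ᵐ ω ∂P, ∀ j, ∀ s ∈ Icc 0 T, v j s ω = W s.toNNReal ω j := by
  obtain ⟨v, hv, hve⟩ := hW.exists_version T
  have hae (j) {s} (hs : s ∈ Icc 0 T) : v j s =ᵐ[P] fun ω => W s.toNNReal ω j :=
    hve.mono fun ω h => h j s hs
  have hmul : ∀ j k, ∀ s ∈ Icc 0 T, ∀ t ∈ Icc 0 T,
      ∫ ω, v j s ω * v k t ω ∂P = (if j = k then 1 else 0) * min s t := by
    intro j k s hs t ht
    have h := hW.integral_mul s.toNNReal t.toNNReal j k
    rw [Real.coe_toNNReal s hs.1, Real.coe_toNNReal t ht.1] at h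
    exact (integral_congr_ae ((hae j hs).mul (hae k ht))).trans h
  refine ⟨v, fun j => ⟨?_, ?_, ?_⟩, ?_, hmul, hve⟩
  · exact (hv j).mono (sup_le_sup le_rfl (MeasurableSpace.comap_mono (hW.pastSigma_le _))) le_rfl
  · exact fun s hs => (hW.memLp _ j).ae_eq (hae j hs).symm
  · intro s hs
    have h := hmul j j s hs s hs
    simp only [if_true, one_mul, min_self] at h
    simpa only [sq, h] using hs.2
  · exact fun j s hs => (integral_congr_ae (hae j hs)).trans (hW.integral_eq_zero _ j)

end Wiener

/-! ### The second moment at the terminal time -/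

section SecondMoment

variable {n m : ℕ} (A : Matrix (Fin n) (Fin n) ℝ) (B : Matrix (Fin n) (Fin m) ℝ) (ε : ℝ) {T σ : ℝ}
  (x₀ x_f : EuclideanSpace ℝ (Fin n))

theorem flow_inv (t : ℝ) : (flow A B ε T σ t)⁻¹ =
    (matM A B ε (T - t) σ)⁻¹ * NormedSpace.exp ((T - t) • A) := by
  rw [flow, Matrix.mul_inv_rev, Matrix.inv_eq_left_inv (exp_smul_mul_exp_neg_smul A (T - t))]

theorem flowCoord_initial : (flow A B ε T σ 0)⁻¹.toEuclideanLin (x₀ - meanZ A x_f T) =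
    (matM A B ε T σ)⁻¹.toEuclideanLin ((NormedSpace.exp (T • A)).toEuclideanLin x₀ - x_f) := by
  rw [flow_inv, sub_zero, toEuclideanLin_mul_apply,
    map_sub (NormedSpace.exp (T • A)).toEuclideanLin,
    meanZ, ← toEuclideanLin_mul_apply, exp_smul_mul_exp_neg_smul, toEuclideanLin_one_apply]

theorem pathSolution_terminal (w : ℝ → EuclideanSpace ℝ (Fin m)) :
    pathSolution A B ε T σ x₀ x_f w T - x_f = σ ^ 2 • flowCoord A B ε T σ x₀ x_f w T := by
  rw [pathSolution, flow_terminal, map_smul, LinearMap.smul_apply, toEuclideanLin_one_apply,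
    meanZ, sub_self]
  simp

theorem matM_inv_transpose (t : ℝ) : ((matM A B ε t σ)⁻¹)ᵀ = (matM A B ε t σ)⁻¹ := by
  rw [Matrix.transpose_nonsing_inv, matM_transpose]

theorem weightedNorm_inv_sq (x : EuclideanSpace ℝ (Fin n)) :
    weightedNorm ((matM A B ε T σ)⁻¹ ^ 2) x ^ 2 =
      ‖(matM A B ε T σ)⁻¹.toEuclideanLin x‖ ^ 2 := by
  have h : x.ofLp ⬝ᵥ ((matM A B ε T σ)⁻¹ ^ 2 *ᵥ x.ofLp) =
      ‖(matM A B ε T σ)⁻¹.toEuclideanLin x‖ ^ 2 := by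
    rw [EuclideanSpace.real_norm_sq_eq, sq, ← Matrix.mulVec_mulVec, Matrix.dotProduct_mulVec,
      ← Matrix.mulVec_transpose, matM_inv_transpose]
    simp only [dotProduct, Matrix.toLpLin_apply, sq]
  rw [weightedNorm, h, Real.sq_sqrt (sq_nonneg _)]

/-- The variance of the terminal coordinate. It is computed by the fundamental theorem of calculus,
because `tr (F Fᵀ)` is the derivative of `t ↦ tr (M_{T-t}⁻¹)`. -/
theorem integral_sum_noiseKernel_sq (hσ : σ ≠ 0) (hT : 0 ≤ T) :
    ∑ i, ∑ j, ∫ s in (0 : ℝ)..T, noiseKernel A B ε T σ s i j * noiseKernel A B ε T σ s i j =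
      n / σ ^ 2 - ((matM A B ε T σ)⁻¹).trace := by
  have hcont : ∀ i j, ContinuousOn (fun s => noiseKernel A B ε T σ s i j) (Icc 0 T) :=
    fun i j t ht => ((hasDerivAt_matrix_iff.1
      (hasDerivAt_noiseKernel A B ε T hσ ht.2) i j).continuousAt).continuousWithinAt
  have hint : ∀ i j, IntervalIntegrable
      (fun s => noiseKernel A B ε T σ s i j * noiseKernel A B ε T σ s i j) volume 0 T :=
    fun i j => ((hcont i j).mul (hcont i j)).intervalIntegrable_of_Icc hT
  have hsum : ∀ s, ∑ i, ∑ j, noiseKernel A B ε T σ s i j * noiseKernel A B ε T σ s i j =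
      (noiseKernel A B ε T σ s * (noiseKernel A B ε T σ s)ᵀ).trace := fun s => by
    simp [Matrix.trace, Matrix.mul_apply]
  have hderiv : ∀ t ∈ uIcc 0 T, HasDerivAt (fun s => ((matM A B ε (T - s) σ)⁻¹).trace)
      (noiseKernel A B ε T σ t * (noiseKernel A B ε T σ t)ᵀ).trace t := by
    intro t ht
    rw [uIcc_of_le hT] at ht
    have h := hasDerivAt_matrix_inv (hasDerivAt_matM_sub A B ε T σ t)
      (isUnit_det_matM A B ε hσ (sub_nonneg.2 ht.2))
    rw [hasDerivAt_matrix_iff] at h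
    refine (HasDerivAt.fun_sum (u := Finset.univ) fun i _ => h i i).congr_deriv ?_
    change Matrix.trace _ = _
    -- `F = ε M_{T-t}⁻¹ e^{A(T-t)} B`, and `M_{T-t}` is symmetric.
    congr 1
    rw [noiseKernel, flow_inv, Matrix.transpose_smul, Matrix.smul_mul, Matrix.mul_smul, smul_smul,
      exp_smul_transpose]
    simp only [Matrix.transpose_mul, matM_inv_transpose, Matrix.mul_neg, Matrix.neg_mul, neg_neg,
      Matrix.mul_smul, Matrix.smul_mul, Matrix.mul_assoc, sq]
  calc _ = ∫ s in (0 : ℝ)..T, (noiseKernel A B ε T σ s * (noiseKernel A B ε T σ s)ᵀ).trace := by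
        simp_rw [← hsum]
        rw [intervalIntegral.integral_finsetSum]
        · exact Finset.sum_congr rfl fun i _ =>
            (intervalIntegral.integral_finsetSum fun j _ => hint i j).symm
        · exact fun i _ => ContinuousOn.intervalIntegrable_of_Icc hT (by fun_prop)
    _ = _ := by
        have hF : ContinuousOn (noiseKernel A B ε T σ) (Icc 0 T) := fun t ht =>
          (continuousAt_of_hasDerivAt_matrix
            (hasDerivAt_noiseKernel A B ε T hσ ht.2)).continuousWithinAt
        rw [intervalIntegral.integral_eq_sub_of_hasDerivAt hderiv]
        · have h1 : (matM A B ε (T - T) σ)⁻¹ = (σ ^ 2)⁻¹ • 1 := by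
            refine Matrix.inv_eq_left_inv ?_
            rw [sub_self, matM_eq, gramian, matrixIntegral_zero, smul_zero, add_zero,
              Matrix.smul_mul, Matrix.one_mul, smul_smul, inv_mul_cancel₀ (by positivity), one_smul]
          rw [h1, sub_zero, Matrix.trace_smul, Matrix.trace_one, Fintype.card_fin, smul_eq_mul]
          ring
        · refine ContinuousOn.intervalIntegrable_of_Icc hT ?_
          simp_rw [← hsum]
          fun_prop

variable {Ω : Type*} {mΩ : MeasurableSpace Ω} {P : Measure Ω}
  {W : ℝ≥0 → Ω → EuclideanSpace ℝ (Fin m)}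

/-- Entrywise, the coordinate of the solution is a sum of Wiener integrals of a version of the
driving process. -/
theorem flowCoord_apply_ae (hσ : σ ≠ 0) (hW : IsWiener W P) {t : ℝ} (ht : t ∈ Icc 0 T)
    {v : Fin m → ℝ → Ω → ℝ}
    (hv : ∀ᵐ ω ∂P, ∀ j, ∀ s ∈ Icc 0 t, v j s ω = W s.toNNReal ω j) :
    ∀ᵐ ω ∂P, ∀ i, flowCoord A B ε T σ x₀ x_f (fun s => W s.toNNReal ω) t i =
      (flow A B ε T σ 0)⁻¹.toEuclideanLin (x₀ - meanZ A x_f T) i +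
        ∑ j, wienerIntegral (fun s => noiseKernel A B ε T σ s i j)
          (fun s => noiseKernelDeriv A B ε T σ s i j) t (v j) ω := by
  filter_upwards [hv, hW.ae_continuous] with ω hω hc i
  have hcw : Continuous fun s : ℝ => W s.toNNReal ω := hc.comp continuous_real_toNNReal
  have hD : ContinuousOn (noiseKernelDeriv A B ε T σ) (Icc 0 t) :=
    (continuousOn_noiseKernelDeriv A B ε T hσ).mono (Icc_subset_Icc_right ht.2)
  have hint := (continuousOn_toEuclideanLin hD hcw.continuousOn).intervalIntegrable_of_Icc
    (μ := volume) ht.1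
  have e := (EuclideanSpace.proj (𝕜 := ℝ) i).intervalIntegral_comp_comm hint
  have e2 : (∫ s in (0 : ℝ)..t,
      (noiseKernelDeriv A B ε T σ s).toEuclideanLin (W s.toNNReal ω)) i =
      ∑ j, ∫ s in (0 : ℝ)..t, noiseKernelDeriv A B ε T σ s i j * v j s ω := by
    refine e.symm.trans (Eq.trans (b := ∫ s in (0 : ℝ)..t, ∑ j,
      noiseKernelDeriv A B ε T σ s i j * W s.toNNReal ω j) rfl ?_)
    rw [intervalIntegral.integral_finsetSum]
    · refine Finset.sum_congr rfl fun j _ => intervalIntegral.integral_congr fun s hs => ?_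
      rw [uIcc_of_le ht.1] at hs
      simp only [hω j s hs]
    · intro j _
      refine ContinuousOn.intervalIntegrable_of_Icc ht.1 ?_
      fun_prop
  rw [flowCoord, PiLp.sub_apply, PiLp.add_apply, e2, add_sub_assoc]
  congr 1
  simp only [wienerIntegral, Finset.sum_sub_distrib]
  congr 1
  simp only [fun j => hω j t ⟨ht.1, le_rfl⟩]
  rfl

theorem integral_norm_sq_flowCoord [IsProbabilityMeasure P] (hσ : σ ≠ 0) (hT : 0 ≤ T)
    (hW : IsWiener W P) :
    Integrable (fun ω => ‖flowCoord A B ε T σ x₀ x_f (fun s => W s.toNNReal ω) T‖ ^ 2) P ∧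
    ∫ ω, ‖flowCoord A B ε T σ x₀ x_f (fun s => W s.toNNReal ω) T‖ ^ 2 ∂P =
      ‖(flow A B ε T σ 0)⁻¹.toEuclideanLin (x₀ - meanZ A x_f T)‖ ^ 2 +
        (n / σ ^ 2 - ((matM A B ε T σ)⁻¹).trace) := by
  obtain ⟨v, hv2, hv0, hvm, hve⟩ := hW.exists_secondOrder T
  set c := (flow A B ε T σ 0)⁻¹.toEuclideanLin (x₀ - meanZ A x_f T) with hc
  have hF (i j) : ∀ t ∈ Icc 0 T, HasDerivAt (fun s => noiseKernel A B ε T σ s i j)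
      (noiseKernelDeriv A B ε T σ t i j) t := fun t ht =>
    hasDerivAt_matrix_iff.1 (hasDerivAt_noiseKernel A B ε T hσ ht.2) i j
  have hF' (i j) : ContinuousOn (fun s => noiseKernelDeriv A B ε T σ s i j) (Icc 0 T) := by
    have := continuousOn_noiseKernelDeriv A B ε T hσ
    fun_prop
  set I : Fin n → Fin m → Ω → ℝ := fun i j =>
    wienerIntegral (fun s => noiseKernel A B ε T σ s i j)
      (fun s => noiseKernelDeriv A B ε T σ s i j) T (v j) with hI
  have hImem (i j) : MemLp (I i j) 2 P := (hv2 j).memLp_wienerIntegral hT (hF' i j)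
  have hI0 (i j) : ∫ ω, I i j ω ∂P = 0 :=
    integral_wienerIntegral_eq_zero hT (hv2 j) (hv0 j) (hF' i j)
  have hII (i j k) : ∫ ω, I i j ω * I i k ω ∂P = (if j = k then 1 else 0) *
      ∫ s in (0 : ℝ)..T, noiseKernel A B ε T σ s i j * noiseKernel A B ε T σ s i k :=
    integral_wienerIntegral_mul_wienerIntegral hT (hv2 j) (hv2 k) (hvm j k)
      (hF i j) (hF' i j) (hF i k) (hF' i k)
  have hae : (fun ω => ‖flowCoord A B ε T σ x₀ x_f (fun s => W s.toNNReal ω) T‖ ^ 2) =ᵐ[P]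
      fun ω => ∑ i, (c i + ∑ j, I i j ω) ^ 2 := by
    filter_upwards [flowCoord_apply_ae A B ε x₀ x_f hσ hW ⟨hT, le_rfl⟩ hve] with ω hω
    rw [EuclideanSpace.real_norm_sq_eq]
    simp only [hω, hI, hc]
  have hmem (i) : MemLp (fun ω => c i + ∑ j, I i j ω) 2 P :=
    (memLp_const (c i)).add (memLp_finsetSum _ fun j _ => hImem i j)
  have hmom (i) : ∫ ω, (c i + ∑ j, I i j ω) ^ 2 ∂P = c i ^ 2 +
      ∑ j, ∫ s in (0 : ℝ)..T, noiseKernel A B ε T σ s i j * noiseKernel A B ε T σ s i j := by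
    have e : (fun ω => (c i + ∑ j, I i j ω) ^ 2) = fun ω =>
        (c i ^ 2 + 2 * c i * ∑ j, I i j ω) + ∑ j, ∑ k, I i j ω * I i k ω := by
      ext ω
      rw [← Finset.sum_mul_sum]
      ring
    have i1 : Integrable (fun ω => ∑ j, I i j ω) P :=
      integrable_finsetSum _ fun j _ => (hImem i j).integrable (by norm_num)
    have i2 (j k) : Integrable (fun ω => I i j ω * I i k ω) P :=
      (hImem i j).integrable_mul (hImem i k)
    rw [e, integral_add (f := fun ω => c i ^ 2 + 2 * c i * ∑ j, I i j ω)
      ((integrable_const _).add (i1.const_mul _))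
      (integrable_finsetSum _ fun j _ => integrable_finsetSum _ fun k _ => i2 j k),
      integral_add (integrable_const _) (i1.const_mul _), integral_const_mul,
      integral_finsetSum _ fun j _ => (hImem i j).integrable (by norm_num),
      integral_finsetSum _ fun j _ => integrable_finsetSum _ fun k _ => i2 j k]
    simp_rw [integral_finsetSum _ fun k _ => i2 _ k, hII, hI0]
    simp
  refine ⟨(integrable_finsetSum _ fun i _ => (hmem i).integrable_sq).congr hae.symm, ?_⟩
  rw [integral_congr_ae hae, integral_finsetSum _ fun i _ => (hmem i).integrable_sq,
    Finset.sum_congr rfl fun i _ => hmom i, Finset.sum_add_distrib,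
    integral_sum_noiseKernel_sq A B ε hσ hT, EuclideanSpace.real_norm_sq_eq]

end SecondMoment

/-! ### Adaptedness of the control -/

section Adapted

variable {n m : ℕ} (A : Matrix (Fin n) (Fin n) ℝ) (B : Matrix (Fin n) (Fin m) ℝ) (ε : ℝ) {T σ : ℝ}
  (x₀ x_f : EuclideanSpace ℝ (Fin n))

theorem measurable_wienerIntegral {Ω : Type*} {mΩ : MeasurableSpace Ω} {t : ℝ} (ht : 0 ≤ t)
    {V : ℝ → Ω → ℝ} (hV : Measurable (Function.uncurry V)) {f f' : ℝ → ℝ}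
    (hf' : ContinuousOn f' (Icc 0 t)) : Measurable (wienerIntegral f f' t V) := by
  have hc : Continuous (IccExtend ht ((Icc 0 t).domRestrict f')) := hf'.domRestrict.Icc_extend'
  have e : (fun ω => ∫ s in (0 : ℝ)..t, f' s * V s ω) =
      fun ω => ∫ s in Ioc 0 t, IccExtend ht ((Icc 0 t).domRestrict f') s * V s ω := by
    ext ω
    rw [intervalIntegral.integral_of_le ht]
    refine setIntegral_congr_fun measurableSet_Ioc fun s hs => ?_
    simp only [IccExtend_of_mem ht _ (Ioc_subset_Icc_self hs), domRestrict_apply]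
  have h1 : StronglyMeasurable (Function.uncurry fun s ω =>
      IccExtend ht ((Icc 0 t).domRestrict f') s * V s ω) :=
    ((hc.measurable.comp measurable_fst).mul hV).stronglyMeasurable
  have h2 : Measurable fun ω => ∫ s in (0 : ℝ)..t, f' s * V s ω := by
    rw [e]
    exact h1.integral_prod_left.measurable
  exact ((hV.comp measurable_prodMk_left).const_mul (f t)).sub h2

theorem continuous_feedback (σ t : ℝ) : Continuous (feedback A B ε T x_f σ t) := by
  unfold feedback
  exact (((LinearMap.continuous_of_finiteDimensional
    (Bᵀ * (covQ A B ε σ (T - t))⁻¹).toEuclideanLin).comp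
      (continuous_id.sub continuous_const)).const_smul (ε ^ 2)).neg

/-- The control at time `t` is almost surely a continuous function of Wiener integrals of a
version that is measurable with respect to the past up to time `t`. -/
theorem aestronglyMeasurable_feedback_pathSolution {Ω : Type*} {mΩ : MeasurableSpace Ω}
    {P : Measure Ω} {W : ℝ≥0 → Ω → EuclideanSpace ℝ (Fin m)} (hσ : σ ≠ 0) (hW : IsWiener W P)
    {t : ℝ} (ht : t ∈ Icc 0 T) :
    AEStronglyMeasurable[pastSigma W t.toNNReal] (fun ω => feedback A B ε T x_f σ t
      (pathSolution A B ε T σ x₀ x_f (fun s => W s.toNNReal ω) t)) P := by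
  obtain ⟨v, hv, hve⟩ := hW.exists_version t
  have hF' (i j) : ContinuousOn (fun s => noiseKernelDeriv A B ε T σ s i j) (Icc 0 t) := by
    have := (continuousOn_noiseKernelDeriv A B ε T hσ).mono (Icc_subset_Icc_right ht.2)
    fun_prop
  let g : Ω → EuclideanSpace ℝ (Fin n) := fun ω => WithLp.toLp 2 fun i =>
    (flow A B ε T σ 0)⁻¹.toEuclideanLin (x₀ - meanZ A x_f T) i +
      ∑ j, wienerIntegral (fun s => noiseKernel A B ε T σ s i j)
        (fun s => noiseKernelDeriv A B ε T σ s i j) t (v j) ω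
  have hg : Measurable[pastSigma W t.toNNReal] g := by
    refine (PiLp.continuous_toLp 2 _).measurable.comp
      (@measurable_pi_lambda _ _ _ (pastSigma W t.toNNReal) _ _ fun i => ?_)
    exact (Finset.measurable_fun_sum _ fun j _ =>
      measurable_wienerIntegral (mΩ := pastSigma W t.toNNReal) ht.1 (hv j) (hF' i j)).const_add _
  have hΦ : Continuous fun z => feedback A B ε T x_f σ t
      (meanZ A x_f (T - t) + (flow A B ε T σ t).toEuclideanLin z) :=
    (continuous_feedback A B ε x_f σ t).comp
      (continuous_const.add (LinearMap.continuous_of_finiteDimensional _))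
  refine ⟨fun ω => feedback A B ε T x_f σ t
    (meanZ A x_f (T - t) + (flow A B ε T σ t).toEuclideanLin (g ω)),
    hΦ.comp_stronglyMeasurable hg.stronglyMeasurable, ?_⟩
  filter_upwards [flowCoord_apply_ae A B ε x₀ x_f hσ hW ht hve] with ω hω
  have e : flowCoord A B ε T σ x₀ x_f (fun s => W s.toNNReal ω) t = g ω := by
    ext i
    exact hω i
  rw [pathSolution, e]

end Adapted

/-! ### Controllability and the Gramian -/

section Controllability

variable {n m : ℕ} (A : Matrix (Fin n) (Fin n) ℝ) (B : Matrix (Fin n) (Fin m) ℝ)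

theorem analyticAt_exp_smul_apply (i j : Fin n) (t : ℝ) :
    AnalyticAt ℝ (fun s : ℝ => NormedSpace.exp (s • A) i j) t := by
  let _ : NormedRing (Matrix (Fin n) (Fin n) ℝ) := Matrix.linftyOpNormedRing
  let _ : NormedAlgebra ℝ (Matrix (Fin n) (Fin n) ℝ) := Matrix.linftyOpNormedAlgebra
  have h1 : AnalyticAt ℝ (fun s : ℝ => s • A) t := analyticAt_id.smul analyticAt_const
  have h2 : AnalyticAt ℝ (fun s : ℝ => NormedSpace.exp (s • A)) t :=
    AnalyticAt.fun_comp (f := fun s : ℝ => s • A) (NormedSpace.exp_analytic (𝕂 := ℝ) (t • A)) h1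
  exact ((Matrix.entryLinearMap ℝ ℝ i j).toContinuousLinearMap.analyticAt _).fun_comp h2

theorem hasDerivAt_exp_sub_smul (τ t : ℝ) :
    HasDerivAt (fun s : ℝ => NormedSpace.exp ((τ - s) • A))
      (-(NormedSpace.exp ((τ - t) • A) * A)) t := by
  let _ : NormedRing (Matrix (Fin n) (Fin n) ℝ) := Matrix.linftyOpNormedRing
  let _ : NormedAlgebra ℝ (Matrix (Fin n) (Fin n) ℝ) := Matrix.linftyOpNormedAlgebra
  exact (hasDerivAt_exp_smul_const (𝕂 := ℝ) A (τ - t)).comp_const_sub τ t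

variable {A B}

/-- A null vector of the Gramian over one interval is orthogonal to the range of `e^{As} B` for
every real `s`, by analyticity. Controllability allows any steering time, so `s ∈ [0, T]` would
not be enough. -/
theorem vecMul_exp_eq_zero_of_gramian {T : ℝ} (hT : 0 < T) {x : Fin n → ℝ}
    (hx : x ⬝ᵥ (gramian A B T *ᵥ x) = 0) (s : ℝ) :
    x ᵥ* (NormedSpace.exp (s • A) * B) = 0 := by
  rw [dotProduct_gramian_mulVec] at hx
  simp only [Matrix.mulVec_transpose] at hx
  have hcont : Continuous fun s : ℝ => (x ᵥ* (NormedSpace.exp (s • A) * B)) := by fun_prop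
  have h0 : ∀ s ∈ Icc 0 T, x ᵥ* (NormedSpace.exp (s • A) * B) = 0 := by
    by_contra! h
    obtain ⟨s, hs, hne⟩ := h
    refine (intervalIntegral.integral_pos hT (hcont.dotProduct hcont).continuousOn
      (fun r _ => Finset.sum_nonneg fun i _ => mul_self_nonneg _) ⟨s, hs, ?_⟩).ne' hx
    refine lt_of_le_of_ne (Finset.sum_nonneg fun i _ => mul_self_nonneg _) fun h => hne ?_
    exact dotProduct_self_eq_zero.1 h.symm
  ext j
  have han : AnalyticOnNhd ℝ (fun s : ℝ => (x ᵥ* (NormedSpace.exp (s • A) * B)) j) univ := by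
    intro t _
    simp only [Matrix.vecMul, dotProduct, Matrix.mul_apply]
    exact Finset.univ.analyticAt_fun_sum fun i _ => analyticAt_const.mul
      (Finset.univ.analyticAt_fun_sum fun k _ =>
        (analyticAt_exp_smul_apply A i k t).mul analyticAt_const)
  refine han.eqOn_zero_of_preconnected_of_eventuallyEq_zero isPreconnected_univ
    (z₀ := T / 2) (mem_univ _) ?_ (mem_univ s)
  filter_upwards [Icc_mem_nhds (half_pos hT) (half_lt_self hT)] with r hr
  simp only [h0 r hr, Pi.zero_apply]

/-- Steer `0` to `x` in time `τ` along `y`. If `x` is orthogonal to the range of every `e^{As} B`,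
then `xᵀ e^{A(τ-t)} y_t` is constant; it is `0` at time `0` and `|x|²` at time `τ`. -/
theorem Controllable.eq_zero_of_vecMul_exp (hc : Controllable A B) {x : Fin n → ℝ}
    (hx : ∀ s : ℝ, x ᵥ* (NormedSpace.exp (s • A) * B) = 0) : x = 0 := by
  obtain ⟨τ, hτ, u, y, -, hy0, hyτ, hy⟩ := hc 0 (WithLp.toLp 2 x)
  have hd : ∀ t ∈ Icc 0 τ, HasDerivWithinAt
      (fun t => (x ᵥ* NormedSpace.exp ((τ - t) • A)) ⬝ᵥ (y t).ofLp) 0 (Icc 0 τ) t := by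
    intro t ht
    have hyk (k) : HasDerivWithinAt (fun t => y t k) ((A *ᵥ (y t).ofLp + B *ᵥ (u t).ofLp) k)
        (Icc 0 τ) t :=
      (EuclideanSpace.proj (𝕜 := ℝ) k).hasFDerivAt.comp_hasDerivWithinAt t (hy t ht)
    have hpk (k) : HasDerivAt (fun t => (x ᵥ* NormedSpace.exp ((τ - t) • A)) k)
        ((-((x ᵥ* NormedSpace.exp ((τ - t) • A)) ᵥ* A)) k) t := by
      rw [Matrix.vecMul_vecMul, ← Matrix.vecMul_neg]
      exact HasDerivAt.fun_sum (u := Finset.univ) fun i _ =>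
        (hasDerivAt_matrix_iff.1 (hasDerivAt_exp_sub_smul A τ t) i k).const_mul (x i)
    refine (HasDerivWithinAt.fun_sum (u := Finset.univ) fun k _ =>
      (hpk k).hasDerivWithinAt.mul (hyk k)).congr_deriv ?_
    rw [Finset.sum_add_distrib]
    change (-((x ᵥ* NormedSpace.exp ((τ - t) • A)) ᵥ* A)) ⬝ᵥ (y t).ofLp +
      (x ᵥ* NormedSpace.exp ((τ - t) • A)) ⬝ᵥ (A *ᵥ (y t).ofLp + B *ᵥ (u t).ofLp) = 0
    rw [dotProduct_add, neg_dotProduct, Matrix.dotProduct_mulVec, Matrix.dotProduct_mulVec,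
      Matrix.vecMul_vecMul _ _ B, hx, zero_dotProduct]
    ring
  have h := constant_of_has_deriv_right_zero (fun t ht => (hd t ht).continuousWithinAt)
    (fun t ht => (hd t ⟨ht.1, ht.2.le⟩).mono_of_mem_nhdsWithin (Icc_mem_nhdsGE_of_mem ht))
    τ ⟨hτ.le, le_rfl⟩
  simpa [hy0, hyτ] using h

theorem Controllable.det_gramian_ne_zero (hc : Controllable A B) {T : ℝ} (hT : 0 < T) :
    (gramian A B T).det ≠ 0 := by
  intro h
  obtain ⟨x, hx, h0⟩ := Matrix.exists_mulVec_eq_zero_iff.2 h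
  exact hx (hc.eq_zero_of_vecMul_exp
    (vecMul_exp_eq_zero_of_gramian hT (by rw [h0, dotProduct_zero])))

end Controllability

/-! ### Vanishing of the terminal error -/

section Vanishing

variable {n m : ℕ} {A : Matrix (Fin n) (Fin n) ℝ} {B : Matrix (Fin n) (Fin m) ℝ} {ε T : ℝ}

theorem continuousAt_matrix_inv {M : Matrix (Fin n) (Fin n) ℝ} (h : IsUnit M.det) :
    ContinuousAt (fun N : Matrix (Fin n) (Fin n) ℝ => N⁻¹) M := by
  let _ : NormedRing (Matrix (Fin n) (Fin n) ℝ) := Matrix.linftyOpNormedRing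
  let _ : NormedAlgebra ℝ (Matrix (Fin n) (Fin n) ℝ) := Matrix.linftyOpNormedAlgebra
  obtain ⟨u, rfl⟩ := (Matrix.isUnit_iff_isUnit_det _).2 h
  simp only [Matrix.nonsing_inv_eq_ringInverse]
  exact NormedRing.inverse_continuousAt u

/-- The mean square terminal error, as a function of `σ`. -/
def terminalError (A : Matrix (Fin n) (Fin n) ℝ) (B : Matrix (Fin n) (Fin m) ℝ) (ε T : ℝ)
    (x₀ x_f : EuclideanSpace ℝ (Fin n)) (σ : ℝ) : ℝ :=
  σ ^ 4 * weightedNorm ((matM A B ε T σ)⁻¹ ^ 2)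
      ((NormedSpace.exp (T • A)).toEuclideanLin x₀ - x_f) ^ 2
    + σ ^ 2 * ((n : ℝ) - σ ^ 2 * ((matM A B ε T σ)⁻¹).trace)

/-- At `σ = 0` the matrix `M` is `ε²` times the Gramian, which is invertible, so the error depends
continuously on `σ` there. -/
theorem Controllable.tendsto_terminalError (hc : Controllable A B) (hε : ε ≠ 0) (hT : 0 < T)
    (x₀ x_f : EuclideanSpace ℝ (Fin n)) :
    Filter.Tendsto (terminalError A B ε T x₀ x_f) (nhds 0) (nhds 0) := by
  have hM0 : IsUnit (matM A B ε T 0).det := by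
    rw [isUnit_iff_ne_zero, matM_eq, zero_pow two_ne_zero, zero_smul, zero_add, Matrix.det_smul]
    exact mul_ne_zero (by positivity) (hc.det_gramian_ne_zero hT)
  have hM : Continuous fun σ : ℝ => matM A B ε T σ := by
    simp only [matM_eq]
    fun_prop
  have hN : ContinuousAt (fun σ : ℝ => (matM A B ε T σ)⁻¹) 0 :=
    ContinuousAt.comp (continuousAt_matrix_inv hM0) hM.continuousAt
  have hΦ : Continuous fun p : ℝ × Matrix (Fin n) (Fin n) ℝ =>
      p.1 ^ 4 * weightedNorm (p.2 ^ 2) ((NormedSpace.exp (T • A)).toEuclideanLin x₀ - x_f) ^ 2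
        + p.1 ^ 2 * ((n : ℝ) - p.1 ^ 2 * p.2.trace) := by
    unfold weightedNorm
    fun_prop
  have h := ContinuousAt.comp (f := fun σ : ℝ => (σ, (matM A B ε T σ)⁻¹)) (x := 0)
    hΦ.continuousAt (continuousAt_id.prodMk hN)
  have h0 : terminalError A B ε T x₀ x_f 0 = 0 := by simp [terminalError]
  have h' : Filter.Tendsto (terminalError A B ε T x₀ x_f) (nhds 0)
      (nhds (terminalError A B ε T x₀ x_f 0)) := h.tendsto
  rwa [h0] at h'

end Vanishing

/-! ### Solutions of the closed-loop equation -/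

section ClosedLoop

variable {n m : ℕ} (A : Matrix (Fin n) (Fin n) ℝ) (B : Matrix (Fin n) (Fin m) ℝ) (ε : ℝ) {T σ : ℝ}
  (x₀ x_f : EuclideanSpace ℝ (Fin n)) {Ω : Type*} {mΩ : MeasurableSpace Ω} {P : Measure Ω}
  {W : ℝ≥0 → Ω → EuclideanSpace ℝ (Fin m)}

theorem isClosedLoop_pathSolution (hσ : σ ≠ 0) (hT : 0 ≤ T) (hW : IsWiener W P) :
    IsClosedLoop A B ε T x₀ (feedback A B ε T x_f σ) P W
      fun t ω => pathSolution A B ε T σ x₀ x_f (fun s => W s.toNNReal ω) t := by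
  filter_upwards [hW.ae_continuous] with ω hω
  have hw : Continuous fun s : ℝ => W s.toNNReal ω := hω.comp continuous_real_toNNReal
  obtain ⟨h1, h2⟩ := pathSolution_spec A B ε T x₀ x_f hσ hT hw
  exact ⟨h1, (continuousOn_drift A B ε T x_f hσ h1).intervalIntegrable_of_Icc hT, h2⟩

theorem IsClosedLoop.ae_eq_pathSolution (hσ : σ ≠ 0) (hT : 0 ≤ T) (hW : IsWiener W P)
    {X : ℝ → Ω → EuclideanSpace ℝ (Fin n)}
    (hX : IsClosedLoop A B ε T x₀ (feedback A B ε T x_f σ) P W X) :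
    ∀ᵐ ω ∂P, ∀ t ∈ Icc 0 T,
      X t ω = pathSolution A B ε T σ x₀ x_f (fun s => W s.toNNReal ω) t := by
  filter_upwards [hX, isClosedLoop_pathSolution A B ε x₀ x_f hσ hT hW] with ω h h'
  exact path_unique A B ε T x₀ x_f hσ hT (w := fun s => W s.toNNReal ω) h.1 h'.1 h.2.2 h'.2.2

theorem IsClosedLoop.integral_norm_sq_sub [IsProbabilityMeasure P] (hσ : σ ≠ 0) (hT : 0 ≤ T)
    (hW : IsWiener W P) {X : ℝ → Ω → EuclideanSpace ℝ (Fin n)}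
    (hX : IsClosedLoop A B ε T x₀ (feedback A B ε T x_f σ) P W X) :
    Integrable (fun ω => ‖X T ω - x_f‖ ^ 2) P ∧
      ∫ ω, ‖X T ω - x_f‖ ^ 2 ∂P = terminalError A B ε T x₀ x_f σ := by
  have hae : (fun ω => ‖X T ω - x_f‖ ^ 2) =ᵐ[P] fun ω =>
      σ ^ 4 * ‖flowCoord A B ε T σ x₀ x_f (fun s => W s.toNNReal ω) T‖ ^ 2 := by
    filter_upwards [hX.ae_eq_pathSolution A B ε x₀ x_f hσ hT hW] with ω hω
    rw [hω T ⟨hT, le_rfl⟩, pathSolution_terminal, norm_smul, mul_pow, Real.norm_eq_abs, sq_abs]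
    ring
  obtain ⟨h1, h2⟩ := integral_norm_sq_flowCoord A B ε x₀ x_f hσ hT hW
  refine ⟨(h1.const_mul _).congr hae.symm, ?_⟩
  rw [integral_congr_ae hae, integral_const_mul, h2, flowCoord_initial, terminalError,
    weightedNorm_inv_sq]
  field_simp

end ClosedLoop

end TerminalError

end

theorem proposition2 {n m : ℕ} (A : Matrix (Fin n) (Fin n) ℝ) (B : Matrix (Fin n) (Fin m) ℝ)
    (ε T : ℝ) (hε : 0 < ε) (hT : 0 < T) (x₀ x_f : EuclideanSpace ℝ (Fin n)) :
    (∀ σ : ℝ, 0 < σ →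
      ∀ (Ω : Type u) (_ : MeasurableSpace Ω) (P : Measure Ω) (_ : IsProbabilityMeasure P)
        (W : ℝ≥0 → Ω → EuclideanSpace ℝ (Fin m)), TerminalError.IsWiener W P →
        (∃ X, TerminalError.IsClosedLoop A B ε T x₀
          (TerminalError.feedback A B ε T x_f σ) P W X) ∧
        ∀ X : ℝ → Ω → EuclideanSpace ℝ (Fin n),
          TerminalError.IsClosedLoop A B ε T x₀ (TerminalError.feedback A B ε T x_f σ) P W X →
          Integrable (fun ω => ‖X T ω - x_f‖ ^ 2) P ∧
          ∫ ω, ‖X T ω - x_f‖ ^ 2 ∂P =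
            σ ^ 4 * TerminalError.weightedNorm ((TerminalError.matM A B ε T σ)⁻¹ ^ 2)
                ((NormedSpace.exp (T • A)).toEuclideanLin x₀ - x_f) ^ 2
              + σ ^ 2 * ((n : ℝ) - σ ^ 2 * ((TerminalError.matM A B ε T σ)⁻¹).trace)) ∧
    (TerminalError.Controllable A B →
      ∀ δ : ℝ, 0 < δ → ∃ σ₀ : ℝ, 0 < σ₀ ∧ ∀ σ : ℝ, 0 < σ → σ ≤ σ₀ →
        TerminalError.SolvesApproxSteering.{u} A B ε T x₀ x_f δ
          (TerminalError.feedback A B ε T x_f σ)) := by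
  refine ⟨fun σ hσ Ω _ P _ W hW => ⟨⟨_, TerminalError.isClosedLoop_pathSolution A B ε x₀ x_f
    hσ.ne' hT.le hW⟩, fun X hX => hX.integral_norm_sq_sub A B ε x₀ x_f hσ.ne' hT.le hW⟩, ?_⟩
  intro hc δ hδ
  obtain ⟨r, hr, hball⟩ := Metric.eventually_nhds_iff.1
    ((hc.tendsto_terminalError hε.ne' hT x₀ x_f).eventually (gt_mem_nhds hδ))
  refine ⟨r / 2, half_pos hr, fun σ hσ hσr Ω _ P _ W hW =>
    ⟨⟨_, TerminalError.isClosedLoop_pathSolution A B ε x₀ x_f hσ.ne' hT.le hW⟩, fun X hX => ?_⟩⟩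
  obtain ⟨hint, hval⟩ := hX.integral_norm_sq_sub A B ε x₀ x_f hσ.ne' hT.le hW
  refine ⟨fun t ht => ?_, hint, ?_⟩
  · refine (TerminalError.aestronglyMeasurable_feedback_pathSolution A B ε x₀ x_f hσ.ne' hW
      ht).congr ?_
    filter_upwards [hX.ae_eq_pathSolution A B ε x₀ x_f hσ.ne' hT.le hW] with ω hω
    rw [hω t ht]
  · rw [hval]
    refine (hball ?_).le
    rw [Real.dist_eq, sub_zero, abs_of_pos hσ]
    linarith
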